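/- **Theorem 3.** Let $A\in\mathbb R^{n\times n}$, $B\in\mathbb R^{n\times m}$, and let $w(0),w(1),\dots$ be i.i.d. random vectors taking the pairwise distinct values $w_1,\dots,w_M\in\mathbb R^n$ with probabilities $p_1,\dots,p_M$, $\sum_i p_i=1$; put $\mathbf W=[w_1\ \cdots\ w_M]$, $\mathbf p_w=(p_1,\dots,p_M)'$, $\mu_w=\mathbf W\mathbf p_w$ ($'$ is the transpose). Consider $x(t+1)=Ax(t)+Bu(t)+w(t)$, $x(0)=x_0\in\mathbb R^n$, with the cost $$J_T(u)=\sum_{t=0}^{T}\mathbf E\big[x'(t)Qx(t)+u'(t)Ru(t)\big]$$ and no terminal weight. Let $J_T^*$ be the infimum of $J_T(u)$ over all square integrable controls $u$ such that $u(t)$ is measurable with respect to $w(0),\dots,w(t-1)$ (the law of the noise being known). Assume H1) $Q$ and $R$ do not depend on time, $Q=Q'\ge 0$, $R=R'>0$; H2) $(A,B)$ is stabilizable and $(A,Q^{1/2})$ is observable. For $0\le t\le T$ let $\Upsilon_T(t)=R+B'P_T(t+1)B$, $$P_T(t)=A'P_T(t+1)A+Q-A'P_T(t+1)B\,\Upsilon_T(t)^{-1}B'P_T(t+1)A,$$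 $$L_T(t)=\big(A'-A'P_T(t+1)B\,\Upsilon_T(t)^{-1}B'\big)\big(P_T(t+1)+L_T(t+1)\big),$$ with $P_T(T+1)=L_T(T+1)=0$, and $$D_T(t)=(P_T(t+1)+L_T(t+1))'B\,\Upsilon_T(t)^{-1}B'(P_T(t+1)+L_T(t+1)).$$ Let $\xi(i)$ be the $j$-th unit vector of $\mathbb R^M$ when $w(i)=w_j$, let $\hat{\mathbf p}(t)=\frac1t\sum_{i=0}^{t-1}\xi(i)$ for $t\ge1$ and $\hat{\mathbf p}(0)=0$ be the linear minimum mean square unbiased estimate (LMMSUE) of $\mathbf p_w$, and let $\hat\mu_w(t)=\mathbf W\hat{\mathbf p}(t)$. Let $\hat u$ be the online policy $$\hat u(t)=-\Upsilon_T(t)^{-1}\big(B'P_T(t+1)Ax(t)+B'P_T(t+1)\hat\mu_w(t)+B'L_T(t+1)\hat\mu_w(t)\big),$$ where $x$ is the state generated by $\hat u$ itself. Then the regret $Reg_T(\hat u)=J_T(\hat u)-J_T^*$ satisfies the following. (i) There is a constant $\hat c>0$, independent of $T$ and $x_0$, such that for all $x_0\in\mathbb R^n$ and all $T\ge0$ $$Reg_T(\hat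 u)\le \mathrm{Tr}\big(D_T(0)\mu_w\mu_w'\big)+\hat c\sum_{t=1}^{T}\frac1t .$$ (ii) For every $x_0$, $Reg_T(\hat u)=O(\ln T)$ as $T\to\infty$. -/

import Mathlib

open MeasureTheory ProbabilityTheory Filter Matrix
open scoped MatrixOrder Topology

noncomputable section

namespace OnlineLQ

/-! Pairs of matrices. -/

/-- `(A, B)` is stabilizable: for some state feedback `u = K x`, every trajectory of the closed
loop `x(t+1) = (A + B K) x(t)` tends to zero. -/
def Stabilizable {n m : ℕ} (A : Matrix (Fin n) (Fin n) ℝ) (B : Matrix (Fin n) (Fin m) ℝ) : Prop :=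
  ∃ K : Matrix (Fin m) (Fin n) ℝ, ∀ x : Fin n → ℝ,
    Tendsto (fun t : ℕ => ((A + B * K) ^ t) *ᵥ x) atTop (𝓝 0)

/-- `(A, C)` is observable: an initial state of `x(t+1) = A x(t)` whose output `y(t) = C x(t)`
vanishes at all times is zero. -/
def Observable {n q : ℕ} (A : Matrix (Fin n) (Fin n) ℝ) (C : Matrix (Fin q) (Fin n) ℝ) : Prop :=
  ∀ x : Fin n → ℝ, (∀ t : ℕ, C *ᵥ ((A ^ t) *ᵥ x) = 0) → x = 0

/-! The Riccati equation and its adjoint, for the weights `Q(t)`, `R(t)` and the terminal weight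
`S = P_{T+1}`. -/

section Riccati

variable {n m : ℕ} (A : Matrix (Fin n) (Fin n) ℝ) (B : Matrix (Fin n) (Fin m) ℝ)
  (Q : ℕ → Matrix (Fin n) (Fin n) ℝ) (R : ℕ → Matrix (Fin m) (Fin m) ℝ)
  (S : Matrix (Fin n) (Fin n) ℝ) (T : ℕ)

/-- `riccatiBack k = P_T(T + 1 - k)`: the backward Riccati recursion, `k` steps from the end. -/
def riccatiBack : ℕ → Matrix (Fin n) (Fin n) ℝ
  | 0 => S
  | k + 1 =>
    Aᵀ * riccatiBack k * A + Q (T - k)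
      - Aᵀ * riccatiBack k * B * (R (T - k) + Bᵀ * riccatiBack k * B)⁻¹ * Bᵀ * riccatiBack k * A

/-- `P_T(t)`, for `t ≤ T + 1`. -/
def riccatiP (t : ℕ) : Matrix (Fin n) (Fin n) ℝ := riccatiBack A B Q R S T (T + 1 - t)

/-- `Υ_T(t) = R(t) + B' P_T(t+1) B`, for `t ≤ T`. -/
def upsilon (t : ℕ) : Matrix (Fin m) (Fin m) ℝ := R t + Bᵀ * riccatiP A B Q R S T (t + 1) * B

/-- `adjointBack k = L_T(T + 1 - k)`: the backward adjoint recursion, `k` steps from the end. -/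
def adjointBack : ℕ → Matrix (Fin n) (Fin n) ℝ
  | 0 => 0
  | k + 1 =>
    (Aᵀ - Aᵀ * riccatiBack A B Q R S T k * B
        * (R (T - k) + Bᵀ * riccatiBack A B Q R S T k * B)⁻¹ * Bᵀ)
      * (riccatiBack A B Q R S T k + adjointBack k)

/-- `L_T(t)`, for `t ≤ T + 1`. -/
def adjointL (t : ℕ) : Matrix (Fin n) (Fin n) ℝ := adjointBack A B Q R S T (T + 1 - t)

/-- `D_T(t) = (P_T(t+1) + L_T(t+1))' B Υ_T(t)⁻¹ B' (P_T(t+1) + L_T(t+1))`, for `t ≤ T`. -/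
def matD (t : ℕ) : Matrix (Fin n) (Fin n) ℝ :=
  (riccatiP A B Q R S T (t + 1) + adjointL A B Q R S T (t + 1))ᵀ * B
    * (upsilon A B Q R S T t)⁻¹ * Bᵀ
    * (riccatiP A B Q R S T (t + 1) + adjointL A B Q R S T (t + 1))

end Riccati

/-! The noise and its estimated statistics. -/

/-- `w(0), w(1), …` are i.i.d. random vectors that take the pairwise distinct values
`w_1, …, w_M` with probabilities `p_1, …, p_M`. -/
structure IsNoise {n M : ℕ} {Ω : Type*} [MeasurableSpace Ω] (μ : Measure Ω)
    (v : Fin M → Fin n → ℝ) (p : Fin M → ℝ) (w : ℕ → Ω → Fin n → ℝ) : Prop where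
  distinct : Function.Injective v
  sum_eq_one : ∑ i, p i = 1
  measurable : ∀ t, Measurable (w t)
  indep : iIndepFun w μ
  law : ∀ t i, μ.real {ω | w t ω = v i} = p i

/-- The matrix `W = [w_1 … w_M]`, whose columns are the values of the noise. -/
def valueMatrix {n M : ℕ} (v : Fin M → Fin n → ℝ) : Matrix (Fin n) (Fin M) ℝ :=
  Matrix.of fun i j => v j i

/-- The mean `μ_w = W p_w` of the noise. -/
def noiseMean {n M : ℕ} (v : Fin M → Fin n → ℝ) (p : Fin M → ℝ) : Fin n → ℝ :=
  valueMatrix v *ᵥ p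

/-- The observation `ξ(t)`: the `j`-th unit vector when `w(t) = w_j`. -/
def obs {n M : ℕ} {Ω : Type*} (v : Fin M → Fin n → ℝ) (w : ℕ → Ω → Fin n → ℝ)
    (t : ℕ) (ω : Ω) : Fin M → ℝ :=
  fun j => open Classical in if w t ω = v j then 1 else 0

/-- The linear minimum mean square unbiased estimate of `p_w` at time `t`: the sample mean
`(1/t) ∑_{i<t} ξ(i)` for `t ≥ 1`, and `0` for `t = 0`. -/
def lmmsue {n M : ℕ} {Ω : Type*} (v : Fin M → Fin n → ℝ) (w : ℕ → Ω → Fin n → ℝ)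
    (t : ℕ) (ω : Ω) : Fin M → ℝ :=
  if t = 0 then 0 else (1 / (t : ℝ)) • ∑ i ∈ Finset.range t, obs v w i ω

/-- The estimate of the mean of the noise, `W` times the estimate of `p_w`. -/
def meanEstimate {n M : ℕ} {Ω : Type*} (v : Fin M → Fin n → ℝ) (w : ℕ → Ω → Fin n → ℝ)
    (t : ℕ) (ω : Ω) : Fin n → ℝ :=
  valueMatrix v *ᵥ lmmsue v w t ω

/-! The controlled system, its cost, and the regret. -/

section System

variable {n m : ℕ} {Ω : Type*} (A : Matrix (Fin n) (Fin n) ℝ) (B : Matrix (Fin n) (Fin m) ℝ)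
  (Q : ℕ → Matrix (Fin n) (Fin n) ℝ) (R : ℕ → Matrix (Fin m) (Fin m) ℝ)
  (S : Matrix (Fin n) (Fin n) ℝ) (T : ℕ) (x₀ : Fin n → ℝ) (w : ℕ → Ω → Fin n → ℝ)

/-- The state driven by the control `u`: `x(0) = x₀`, `x(t+1) = A x(t) + B u(t) + w(t)`. -/
def state (u : ℕ → Ω → Fin m → ℝ) : ℕ → Ω → Fin n → ℝ
  | 0 => fun _ => x₀
  | t + 1 => fun ω => A *ᵥ state u t ω + B *ᵥ u t ω + w t ω

/-- The cost `J_T(u) = ∑_{t=0}^T E[x(t)' Q(t) x(t) + u(t)' R(t) u(t)] + E[x(T+1)' S x(T+1)]`. -/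
def cost [MeasurableSpace Ω] (μ : Measure Ω) (u : ℕ → Ω → Fin m → ℝ) : ℝ :=
  (∑ t ∈ Finset.range (T + 1),
    ∫ ω, (state A B x₀ w u t ω ⬝ᵥ (Q t *ᵥ state A B x₀ w u t ω)
      + u t ω ⬝ᵥ (R t *ᵥ u t ω)) ∂μ)
  + ∫ ω, state A B x₀ w u (T + 1) ω ⬝ᵥ (S *ᵥ state A B x₀ w u (T + 1) ω) ∂μ

/-- The σ-algebra generated by `w(0), …, w(t-1)`: the information that the states
`x(0), …, x(t)` carry when the decision maker knows the controls applied so far. -/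
abbrev history (t : ℕ) : MeasurableSpace Ω :=
  ⨆ (s : ℕ) (_ : s < t), MeasurableSpace.comap (w s) inferInstance

/-- Nonanticipative square integrable controls. They may depend in any way on the law of the
noise. -/
def Admissible [MeasurableSpace Ω] (μ : Measure Ω) (u : ℕ → Ω → Fin m → ℝ) : Prop :=
  ∀ t, Measurable[history w t] (u t) ∧ MemLp (u t) 2 μ

/-- The known-statistics optimum `J_T^*`: the least cost of an admissible control. -/
def optimalCost [MeasurableSpace Ω] (μ : Measure Ω) : ℝ :=
  sInf {J : ℝ | ∃ u : ℕ → Ω → Fin m → ℝ, Admissible w μ u ∧ J = cost A B Q R S T x₀ w μ u}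

/-- The online feedback law: the control applied at time `t` in the state `x` when the current
estimate of the mean of the noise is `e`,
`-Υ_T(t)⁻¹ (B' P_T(t+1) A x + B' P_T(t+1) e + B' L_T(t+1) e)`. -/
def feedback (t : ℕ) (x e : Fin n → ℝ) : Fin m → ℝ :=
  -((upsilon A B Q R S T t)⁻¹ *ᵥ
    ((Bᵀ * riccatiP A B Q R S T (t + 1) * A) *ᵥ x
      + (Bᵀ * riccatiP A B Q R S T (t + 1)) *ᵥ e
      + (Bᵀ * adjointL A B Q R S T (t + 1)) *ᵥ e))

/-- The state under the online policy. -/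
def onlineState {M : ℕ} (v : Fin M → Fin n → ℝ) : ℕ → Ω → Fin n → ℝ
  | 0 => fun _ => x₀
  | t + 1 => fun ω =>
    A *ᵥ onlineState v t ω
      + B *ᵥ feedback A B Q R S T t (onlineState v t ω) (meanEstimate v w t ω) + w t ω

/-- The online policy `û`: the feedback law applied to the current state and the current estimate
of the mean of the noise. It does not involve the probabilities of the noise. -/
def onlinePolicy {M : ℕ} (v : Fin M → Fin n → ℝ) (t : ℕ) (ω : Ω) : Fin m → ℝ :=
  feedback A B Q R S T t (onlineState A B Q R S T x₀ w v t ω) (meanEstimate v w t ω)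

/-- The regret `J_T(û) - J_T^*` of the online policy. -/
def regret {M : ℕ} [MeasurableSpace Ω] (μ : Measure Ω) (v : Fin M → Fin n → ℝ) : ℝ :=
  cost A B Q R S T x₀ w μ (onlinePolicy A B Q R S T x₀ w v) - optimalCost A B Q R S T x₀ w μ

end System

end OnlineLQ

end

/-!
For a known mean `e` of the noise, the cost-to-go is the quadratic function
`x ↦ x'P_T(t)x + 2 x'L_T(t)e` plus a constant. Completing the square stage by stage shows that
every admissible control `u` costs `∑ E[(u(t) - u°(t))' Υ_T(t) (u(t) - u°(t))]` more than a
constant that does not depend on `u`, where `u°` is the feedback law with the true mean `μ_w`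
inserted; the cross terms vanish, as `w(t) - μ_w` is centred and independent of the past. For the
online policy the difference `û(t) - u°(t)` is linear in the estimation error, so the regret is at
most `∑ E[(μ̂_w(t) - μ_w)' D_T(t) (μ̂_w(t) - μ_w)]`. The term `t = 0` is the trace, and the error of
a sample mean has variance `O(1/t)`.

It remains to bound `D_T(t)` uniformly. Stabilizability bounds the Riccati iterates `V_k` by the
cost of a fixed stabilizing feedback. By observability some `V_N` is positive definite, and then
`a V_{N+j} - l ∑_{i<N} V_i` is, for suitable `a` and `l`, a Lyapunov function of the time-varying
optimal closed loop. The loop thus contracts exponentially, which bounds the iterates of the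
adjoint recursion.
-/

namespace OnlineLQ

section QuadraticForms

variable {ι κ : Type*} [Fintype ι] [Fintype κ]

theorem dotProduct_mulVec_comm_of_isSymm {α : Type*} [CommSemiring α] {M : Matrix ι ι α}
    (hM : M.IsSymm) (x y : ι → α) : x ⬝ᵥ M *ᵥ y = y ⬝ᵥ M *ᵥ x := by
  rw [← dotProduct_transpose_mulVec, hM.eq]

theorem posSemidef_real_iff {M : Matrix ι ι ℝ} :
    M.PosSemidef ↔ M.IsSymm ∧ ∀ x, 0 ≤ x ⬝ᵥ M *ᵥ x := by
  simp only [posSemidef_iff_dotProduct_mulVec, isHermitian_iff_isSymm, star_trivial]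

theorem add_dotProduct_mulVec_add {α : Type*} [CommSemiring α] {M : Matrix ι ι α}
    (hM : M.IsSymm) (x y : ι → α) :
    (x + y) ⬝ᵥ M *ᵥ (x + y) = x ⬝ᵥ M *ᵥ x + 2 * (x ⬝ᵥ M *ᵥ y) + y ⬝ᵥ M *ᵥ y := by
  rw [mulVec_add, dotProduct_add, add_dotProduct, add_dotProduct,
    dotProduct_mulVec_comm_of_isSymm hM y x]
  ring

theorem norm_sq_toLp (x : ι → ℝ) : ‖WithLp.toLp 2 x‖ ^ 2 = x ⬝ᵥ x := by
  rw [EuclideanSpace.real_norm_sq_eq]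
  simp only [dotProduct, sq]

theorem exists_transpose_mul_self_eq {M : Matrix ι ι ℝ} (hM : M.PosSemidef) :
    ∃ S : Matrix ι ι ℝ, Sᵀ * S = M := by
  classical
  have hS : (CFC.sqrt M).PosSemidef := nonneg_iff_posSemidef.1 (CFC.sqrt_nonneg M)
  refine ⟨CFC.sqrt M, ?_⟩
  rw [(posSemidef_real_iff.1 hS).1.eq, CFC.sqrt_mul_sqrt_self M hM.nonneg]

theorem dotProduct_transpose_mul_mulVec {α ν : Type*} [CommSemiring α] [Fintype ν]
    (S : Matrix κ ι α) (N : Matrix κ ν α) (x : ι → α) (y : ν → α) :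
    x ⬝ᵥ (Sᵀ * N) *ᵥ y = (S *ᵥ x) ⬝ᵥ (N *ᵥ y) := by
  rw [← mulVec_mulVec, dotProduct_transpose_mulVec, dotProduct_comm]

variable [DecidableEq ι]

open scoped Matrix.Norms.L2Operator

theorem mulVec_dotProduct_self_le (M : Matrix κ ι ℝ) (x : ι → ℝ) :
    (M *ᵥ x) ⬝ᵥ (M *ᵥ x) ≤ ‖M‖ ^ 2 * (x ⬝ᵥ x) := by
  rw [← norm_sq_toLp, ← norm_sq_toLp, ← mul_pow]
  exact pow_le_pow_left₀ (norm_nonneg _) (l2_opNorm_mulVec M (WithLp.toLp 2 x)) 2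

theorem dotProduct_mulVec_le_norm (M : Matrix ι ι ℝ) (x : ι → ℝ) :
    x ⬝ᵥ M *ᵥ x ≤ ‖M‖ * (x ⬝ᵥ x) := by
  have h := real_inner_le_norm (WithLp.toLp 2 (M *ᵥ x)) (WithLp.toLp 2 x)
  rw [EuclideanSpace.inner_eq_star_dotProduct, star_trivial] at h
  calc x ⬝ᵥ M *ᵥ x ≤ ‖WithLp.toLp 2 (M *ᵥ x)‖ * ‖WithLp.toLp 2 x‖ := h
    _ ≤ (‖M‖ * ‖WithLp.toLp 2 x‖) * ‖WithLp.toLp 2 x‖ := by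
        gcongr
        exact l2_opNorm_mulVec M (WithLp.toLp 2 x)
    _ = ‖M‖ * (x ⬝ᵥ x) := by rw [← norm_sq_toLp]; ring

theorem l2_opNorm_le_of_forall {M : Matrix κ ι ℝ} {C : ℝ} (hC : 0 ≤ C)
    (h : ∀ x, (M *ᵥ x) ⬝ᵥ (M *ᵥ x) ≤ C ^ 2 * (x ⬝ᵥ x)) : ‖M‖ ≤ C := by
  rw [l2_opNorm_def]
  refine ContinuousLinearMap.opNorm_le_bound _ hC fun x => ?_
  have hx := h x.ofLp
  rw [← norm_sq_toLp, ← norm_sq_toLp, ← mul_pow] at hx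
  exact le_of_sq_le_sq hx (by positivity)

theorem l2_opNorm_transpose [DecidableEq κ] (M : Matrix κ ι ℝ) : ‖Mᵀ‖ = ‖M‖ := by
  rw [← conjTranspose_eq_transpose_of_trivial, l2_opNorm_conjTranspose]

theorem l2_opNorm_le_of_posSemidef {M : Matrix ι ι ℝ} (hM : M.PosSemidef) {C : ℝ} (hC : 0 ≤ C)
    (h : ∀ x, x ⬝ᵥ M *ᵥ x ≤ C * (x ⬝ᵥ x)) : ‖M‖ ≤ C := by
  obtain ⟨S, rfl⟩ := exists_transpose_mul_self_eq hM
  have hS : ‖S‖ ≤ √C := l2_opNorm_le_of_forall (Real.sqrt_nonneg C) fun x => by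
    rw [Real.sq_sqrt hC, ← dotProduct_transpose_mul_mulVec]
    exact h x
  calc ‖Sᵀ * S‖ ≤ ‖Sᵀ‖ * ‖S‖ := l2_opNorm_mul _ _
    _ = ‖S‖ * ‖S‖ := by rw [l2_opNorm_transpose]
    _ ≤ √C * √C := by gcongr
    _ = C := Real.mul_self_sqrt hC

omit [DecidableEq ι] in
theorem exists_dotProduct_self_le_of_posDef {M : Matrix ι ι ℝ} (hM : M.PosDef) :
    ∃ c : ℝ, 0 ≤ c ∧ ∀ x, x ⬝ᵥ x ≤ c * (x ⬝ᵥ M *ᵥ x) := by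
  classical
  obtain ⟨S, rfl⟩ := exists_transpose_mul_self_eq hM.posSemidef
  have hinv : ((Sᵀ * S)⁻¹ * Sᵀ) * S = 1 := by
    rw [Matrix.mul_assoc, nonsing_inv_mul _ ((isUnit_iff_isUnit_det _).1 hM.isUnit)]
  refine ⟨‖(Sᵀ * S)⁻¹ * Sᵀ‖ ^ 2, by positivity, fun x => ?_⟩
  have h := mulVec_dotProduct_self_le ((Sᵀ * S)⁻¹ * Sᵀ) (S *ᵥ x)
  rwa [mulVec_mulVec, hinv, one_mulVec, ← dotProduct_transpose_mul_mulVec] at h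

theorem l2_opNorm_inv_le_of_coercive {M : Matrix ι ι ℝ} (hM : IsUnit M) {c : ℝ} (hc : 0 ≤ c)
    (h : ∀ x, x ⬝ᵥ x ≤ c * (x ⬝ᵥ M *ᵥ x)) : ‖M⁻¹‖ ≤ c := by
  refine l2_opNorm_le_of_forall hc fun x => ?_
  set y := M⁻¹ *ᵥ x with hy
  have hMy : M *ᵥ y = x := by
    rw [hy, mulVec_mulVec, mul_nonsing_inv _ ((isUnit_iff_isUnit_det _).1 hM), one_mulVec]
  have hcoer : y ⬝ᵥ y ≤ c * (y ⬝ᵥ x) := hMy ▸ h y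
  have hsq : 0 ≤ (y - c • x) ⬝ᵥ (y - c • x) := by
    simpa using dotProduct_star_self_nonneg (y - c • x)
  simp only [sub_dotProduct, dotProduct_sub, smul_dotProduct, dotProduct_smul, smul_eq_mul,
    dotProduct_comm x y] at hsq
  linarith

end QuadraticForms

/-! ### One step of the Riccati recursion -/

section RiccatiStep

variable {ι κ : Type*} [Fintype ι]

/-- The quadratic function `x'Px + 2x'g`, the form in which cost-to-go functions occur; their
constant terms are accounted for separately. -/
def quadFn (P : Matrix ι ι ℝ) (g x : ι → ℝ) : ℝ := x ⬝ᵥ P *ᵥ x + 2 * (x ⬝ᵥ g)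

theorem quadFn_zero_right (P : Matrix ι ι ℝ) (x : ι → ℝ) : quadFn P 0 x = x ⬝ᵥ P *ᵥ x := by
  rw [quadFn, dotProduct_zero, mul_zero, add_zero]

theorem quadFn_add {P : Matrix ι ι ℝ} (hP : P.IsSymm) (g e x d : ι → ℝ) :
    quadFn P g (x + d) = quadFn P (P *ᵥ e + g) x + 2 * (x ⬝ᵥ P *ᵥ (d - e)) + quadFn P g d := by
  simp only [quadFn, add_dotProduct_mulVec_add hP, add_dotProduct, dotProduct_add, mulVec_sub,
    dotProduct_sub]
  ring

variable [Fintype κ] [DecidableEq κ]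

/-- The weight `R + B'PB` that the control receives when the next state is penalised by `P`. -/
def controlWeight (B : Matrix ι κ ℝ) (R : Matrix κ κ ℝ) (P : Matrix ι ι ℝ) : Matrix κ κ ℝ :=
  R + Bᵀ * P * B

/-- One step of the Riccati recursion: the quadratic form of the optimal cost when one stage with
weights `Q`, `R` is followed by the terminal weight `P`. -/
noncomputable def riccatiStep (A : Matrix ι ι ℝ) (B : Matrix ι κ ℝ) (Q : Matrix ι ι ℝ)
    (R : Matrix κ κ ℝ) (P : Matrix ι ι ℝ) : Matrix ι ι ℝ :=
  Aᵀ * P * A + Q - Aᵀ * P * B * (controlWeight B R P)⁻¹ * Bᵀ * P * A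

/-- The closed loop matrix of the feedback that is optimal for the terminal weight `P`. -/
noncomputable def closedLoop (A : Matrix ι ι ℝ) (B : Matrix ι κ ℝ) (R : Matrix κ κ ℝ)
    (P : Matrix ι ι ℝ) : Matrix ι ι ℝ :=
  A - B * (controlWeight B R P)⁻¹ * Bᵀ * P * A

/-- The control that is optimal in the state `x` for the terminal cost `quadFn P g`. -/
noncomputable def optimalControl (A : Matrix ι ι ℝ) (B : Matrix ι κ ℝ) (R : Matrix κ κ ℝ)
    (P : Matrix ι ι ℝ) (g x : ι → ℝ) : κ → ℝ :=
  -((controlWeight B R P)⁻¹ *ᵥ Bᵀ *ᵥ (P *ᵥ A *ᵥ x + g))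

variable {A : Matrix ι ι ℝ} {B : Matrix ι κ ℝ} {Q : Matrix ι ι ℝ} {R : Matrix κ κ ℝ}
  {P : Matrix ι ι ℝ}

omit [Fintype ι] in
theorem dotProduct_mulVec_add_two_mul {Υ : Matrix κ κ ℝ} (hΥ : Υ.IsSymm) (hu : IsUnit Υ)
    (u b : κ → ℝ) :
    u ⬝ᵥ Υ *ᵥ u + 2 * (u ⬝ᵥ b) = (u + Υ⁻¹ *ᵥ b) ⬝ᵥ Υ *ᵥ (u + Υ⁻¹ *ᵥ b) - b ⬝ᵥ Υ⁻¹ *ᵥ b := by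
  have hinv : Υ *ᵥ Υ⁻¹ *ᵥ b = b := by
    rw [mulVec_mulVec, mul_nonsing_inv _ ((isUnit_iff_isUnit_det _).1 hu), one_mulVec]
  rw [add_dotProduct_mulVec_add hΥ, hinv, dotProduct_comm (Υ⁻¹ *ᵥ b)]
  ring

omit [DecidableEq κ] in
theorem stage_cost_eq (hP : P.IsSymm) (g x : ι → ℝ) (u : κ → ℝ) :
    x ⬝ᵥ Q *ᵥ x + u ⬝ᵥ R *ᵥ u + quadFn P g (A *ᵥ x + B *ᵥ u)
      = x ⬝ᵥ Q *ᵥ x + quadFn P g (A *ᵥ x)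
        + (u ⬝ᵥ controlWeight B R P *ᵥ u + 2 * (u ⬝ᵥ Bᵀ *ᵥ (P *ᵥ A *ᵥ x + g))) := by
  have hBu : u ⬝ᵥ Bᵀ *ᵥ (P *ᵥ A *ᵥ x + g) = (A *ᵥ x) ⬝ᵥ P *ᵥ B *ᵥ u + (B *ᵥ u) ⬝ᵥ g := by
    rw [dotProduct_transpose_mulVec, add_dotProduct, dotProduct_comm (P *ᵥ _),
      dotProduct_mulVec_comm_of_isSymm hP, dotProduct_comm g]
  have hΥ : u ⬝ᵥ controlWeight B R P *ᵥ u = u ⬝ᵥ R *ᵥ u + (B *ᵥ u) ⬝ᵥ P *ᵥ B *ᵥ u := by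
    rw [controlWeight, add_mulVec, dotProduct_add, Matrix.mul_assoc, ← mulVec_mulVec,
      dotProduct_transpose_mulVec, dotProduct_comm _ (B *ᵥ u), mulVec_mulVec]
  rw [hBu, hΥ, quadFn, quadFn, add_dotProduct_mulVec_add hP, add_dotProduct]
  ring

theorem stage_cost_eq_optimal_add (hP : P.IsSymm) (hΥ : (controlWeight B R P).IsSymm)
    (hu : IsUnit (controlWeight B R P)) (g x : ι → ℝ) (u : κ → ℝ) :
    x ⬝ᵥ Q *ᵥ x + u ⬝ᵥ R *ᵥ u + quadFn P g (A *ᵥ x + B *ᵥ u)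
      = quadFn (riccatiStep A B Q R P) ((closedLoop A B R P)ᵀ *ᵥ g) x
        + (u - optimalControl A B R P g x) ⬝ᵥ
          controlWeight B R P *ᵥ (u - optimalControl A B R P g x)
        - (Bᵀ *ᵥ g) ⬝ᵥ (controlWeight B R P)⁻¹ *ᵥ Bᵀ *ᵥ g := by
  have hΥinv : ((controlWeight B R P)⁻¹).IsSymm := by
    rw [IsSymm, transpose_nonsing_inv, hΥ.eq]
  set s := Bᵀ *ᵥ P *ᵥ A *ᵥ x with hs
  have hs' : (Bᵀ * P * A) *ᵥ x = s := by simp only [hs, mulVec_mulVec, Matrix.mul_assoc]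
  have hriccati : x ⬝ᵥ riccatiStep A B Q R P *ᵥ x
      = x ⬝ᵥ Q *ᵥ x + (A *ᵥ x) ⬝ᵥ P *ᵥ A *ᵥ x - s ⬝ᵥ (controlWeight B R P)⁻¹ *ᵥ s := by
    have hstep : riccatiStep A B Q R P = Q + Aᵀ * (P * A)
        - (Bᵀ * P * A)ᵀ * ((controlWeight B R P)⁻¹ * (Bᵀ * P * A)) := by
      simp only [riccatiStep, transpose_mul, transpose_transpose, hP.eq, Matrix.mul_assoc, add_comm]
    rw [hstep, sub_mulVec, add_mulVec, dotProduct_sub, dotProduct_add,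
      dotProduct_transpose_mul_mulVec, dotProduct_transpose_mul_mulVec, ← mulVec_mulVec _ P A, hs',
      ← mulVec_mulVec _ _ (Bᵀ * P * A), hs']
  have hclosed : x ⬝ᵥ (closedLoop A B R P)ᵀ *ᵥ g
      = (A *ᵥ x) ⬝ᵥ g - s ⬝ᵥ (controlWeight B R P)⁻¹ *ᵥ Bᵀ *ᵥ g := by
    have hmul : closedLoop A B R P *ᵥ x
        = A *ᵥ x - B *ᵥ (controlWeight B R P)⁻¹ *ᵥ s := by
      simp only [closedLoop, sub_mulVec, hs, mulVec_mulVec, Matrix.mul_assoc]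
    rw [dotProduct_transpose_mulVec, hmul, dotProduct_sub, dotProduct_comm g (A *ᵥ x),
      ← dotProduct_transpose_mulVec, dotProduct_comm (_ *ᵥ s),
      dotProduct_mulVec_comm_of_isSymm hΥinv]
  rw [stage_cost_eq hP, dotProduct_mulVec_add_two_mul hΥ hu, optimalControl, sub_neg_eq_add,
    mulVec_add, add_dotProduct_mulVec_add hΥinv, quadFn, quadFn, hriccati, hclosed]
  ring

theorem closedLoop_transpose (hR : R.IsSymm) (hP : P.IsSymm) :
    (closedLoop A B R P)ᵀ = Aᵀ - Aᵀ * P * B * (controlWeight B R P)⁻¹ * Bᵀ := by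
  have hΥ : (controlWeight B R P)ᵀ = controlWeight B R P := by
    simp only [controlWeight, transpose_add, transpose_mul, transpose_transpose, hR.eq, hP.eq,
      Matrix.mul_assoc]
  simp only [closedLoop, transpose_sub, transpose_mul, transpose_nonsing_inv, transpose_transpose,
    hΥ, hP.eq, Matrix.mul_assoc]

theorem add_mulVec_optimalControl_zero (x : ι → ℝ) :
    A *ᵥ x + B *ᵥ optimalControl A B R P 0 x = closedLoop A B R P *ᵥ x := by
  simp only [optimalControl, closedLoop, add_zero, mulVec_neg, sub_mulVec, mulVec_mulVec,
    Matrix.mul_assoc, ← sub_eq_add_neg]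

omit [Fintype κ] [DecidableEq κ] in
theorem posDef_controlWeight [Finite κ] (B : Matrix ι κ ℝ) (hR : R.PosDef) (hP : P.PosSemidef) :
    (controlWeight B R P).PosDef := by
  refine hR.add_posSemidef ?_
  simpa only [conjTranspose_eq_transpose_of_trivial] using hP.conjTranspose_mul_mul_same B

theorem dotProduct_riccatiStep_mulVec (hR : R.PosDef) (hP : P.PosSemidef) (x : ι → ℝ)
    (u : κ → ℝ) :
    x ⬝ᵥ riccatiStep A B Q R P *ᵥ x
        + (u - optimalControl A B R P 0 x) ⬝ᵥ
          controlWeight B R P *ᵥ (u - optimalControl A B R P 0 x)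
      = x ⬝ᵥ Q *ᵥ x + u ⬝ᵥ R *ᵥ u + (A *ᵥ x + B *ᵥ u) ⬝ᵥ P *ᵥ (A *ᵥ x + B *ᵥ u) := by
  have hΥ := posDef_controlWeight B hR hP
  have h := stage_cost_eq_optimal_add (A := A) (Q := Q) (posSemidef_real_iff.1 hP).1
    (posSemidef_real_iff.1 hΥ.posSemidef).1 hΥ.isUnit 0 x u
  simpa only [mulVec_zero, quadFn_zero_right, zero_dotProduct, sub_zero] using h.symm

theorem dotProduct_riccatiStep_mulVec_le (hR : R.PosDef) (hP : P.PosSemidef) (x : ι → ℝ)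
    (u : κ → ℝ) :
    x ⬝ᵥ riccatiStep A B Q R P *ᵥ x
      ≤ x ⬝ᵥ Q *ᵥ x + u ⬝ᵥ R *ᵥ u + (A *ᵥ x + B *ᵥ u) ⬝ᵥ P *ᵥ (A *ᵥ x + B *ᵥ u) := by
  rw [← dotProduct_riccatiStep_mulVec hR hP x u]
  exact le_add_of_nonneg_right
    ((posSemidef_real_iff.1 (posDef_controlWeight B hR hP).posSemidef).2 _)

theorem dotProduct_riccatiStep_mulVec_eq (hR : R.PosDef) (hP : P.PosSemidef) (x : ι → ℝ) :
    x ⬝ᵥ riccatiStep A B Q R P *ᵥ x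
      = x ⬝ᵥ Q *ᵥ x + optimalControl A B R P 0 x ⬝ᵥ R *ᵥ optimalControl A B R P 0 x
        + (closedLoop A B R P *ᵥ x) ⬝ᵥ P *ᵥ closedLoop A B R P *ᵥ x := by
  have h := dotProduct_riccatiStep_mulVec (A := A) (B := B) (Q := Q) hR hP x
    (optimalControl A B R P 0 x)
  rwa [sub_self, zero_dotProduct, add_zero, add_mulVec_optimalControl_zero] at h

theorem posSemidef_riccatiStep (hQ : Q.PosSemidef) (hR : R.PosDef) (hP : P.PosSemidef) :
    (riccatiStep A B Q R P).PosSemidef := by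
  have hPs := (posSemidef_real_iff.1 hP).1
  have hQs := (posSemidef_real_iff.1 hQ).1
  have hΥs := (posSemidef_real_iff.1 (posDef_controlWeight B hR hP).posSemidef).1
  refine posSemidef_real_iff.2 ⟨?_, fun x => ?_⟩
  · simp only [IsSymm, riccatiStep, transpose_sub, transpose_add, transpose_mul,
      transpose_transpose, transpose_nonsing_inv, hPs.eq, hQs.eq, hΥs.eq, Matrix.mul_assoc]
  · rw [dotProduct_riccatiStep_mulVec_eq hR hP]
    exact add_nonneg (add_nonneg ((posSemidef_real_iff.1 hQ).2 _)
      ((posSemidef_real_iff.1 hR.posSemidef).2 _)) ((posSemidef_real_iff.1 hP).2 _)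

/-- One step of the adjoint recursion: it maps the linear part `L` of the cost-to-go, as a
function of the mean of the noise, to the one a stage earlier. -/
noncomputable def adjointStep (A : Matrix ι ι ℝ) (B : Matrix ι κ ℝ) (R : Matrix κ κ ℝ)
    (P L : Matrix ι ι ℝ) : Matrix ι ι ℝ :=
  (closedLoop A B R P)ᵀ * (P + L)

/-- The quadratic form of the loss that is incurred in one stage by an error in the estimate of
the mean of the noise. -/
noncomputable def errorWeight (B : Matrix ι κ ℝ) (R : Matrix κ κ ℝ) (P L : Matrix ι ι ℝ) :
    Matrix ι ι ℝ :=
  (P + L)ᵀ * B * (controlWeight B R P)⁻¹ * Bᵀ * (P + L)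

theorem dotProduct_errorWeight_mulVec (L : Matrix ι ι ℝ) (e : ι → ℝ) :
    e ⬝ᵥ errorWeight B R P L *ᵥ e
      = (Bᵀ *ᵥ (P + L) *ᵥ e) ⬝ᵥ (controlWeight B R P)⁻¹ *ᵥ Bᵀ *ᵥ (P + L) *ᵥ e := by
  have h : errorWeight B R P L
      = (Bᵀ * (P + L))ᵀ * ((controlWeight B R P)⁻¹ * (Bᵀ * (P + L))) := by
    simp only [errorWeight, transpose_mul, transpose_transpose, Matrix.mul_assoc]
  rw [h, dotProduct_transpose_mul_mulVec]
  simp only [mulVec_mulVec]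

theorem stage_cost_add_noise_eq (hR : R.PosDef) (hP : P.PosSemidef) (L : Matrix ι ι ℝ)
    (e d x : ι → ℝ) (u : κ → ℝ) :
    x ⬝ᵥ Q *ᵥ x + u ⬝ᵥ R *ᵥ u + quadFn P (L *ᵥ e) (A *ᵥ x + B *ᵥ u + d)
      = quadFn (riccatiStep A B Q R P) (adjointStep A B R P L *ᵥ e) x
        + (u - optimalControl A B R P ((P + L) *ᵥ e) x) ⬝ᵥ
          controlWeight B R P *ᵥ (u - optimalControl A B R P ((P + L) *ᵥ e) x)
        + 2 * ((A *ᵥ x + B *ᵥ u) ⬝ᵥ P *ᵥ (d - e))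
        + (quadFn P (L *ᵥ e) d - e ⬝ᵥ errorWeight B R P L *ᵥ e) := by
  have hΥ := posDef_controlWeight B hR hP
  have h := stage_cost_eq_optimal_add (A := A) (Q := Q) (posSemidef_real_iff.1 hP).1
    (posSemidef_real_iff.1 hΥ.posSemidef).1 hΥ.isUnit ((P + L) *ᵥ e) x u
  rw [quadFn_add (posSemidef_real_iff.1 hP).1 _ e, ← add_mulVec, dotProduct_errorWeight_mulVec,
    adjointStep, ← mulVec_mulVec]
  linarith

theorem optimalControl_sub_dotProduct_mulVec (hR : R.PosDef) (hP : P.PosSemidef)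
    (L : Matrix ι ι ℝ) (e e' x : ι → ℝ) :
    (optimalControl A B R P ((P + L) *ᵥ e') x - optimalControl A B R P ((P + L) *ᵥ e) x) ⬝ᵥ
        controlWeight B R P *ᵥ
          (optimalControl A B R P ((P + L) *ᵥ e') x - optimalControl A B R P ((P + L) *ᵥ e) x)
      = (e' - e) ⬝ᵥ errorWeight B R P L *ᵥ (e' - e) := by
  have hu := (isUnit_iff_isUnit_det _).1 (posDef_controlWeight B hR hP).isUnit
  have hsub : optimalControl A B R P ((P + L) *ᵥ e') x - optimalControl A B R P ((P + L) *ᵥ e) x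
      = -((controlWeight B R P)⁻¹ *ᵥ Bᵀ *ᵥ (P + L) *ᵥ (e' - e)) := by
    simp only [optimalControl, mulVec_add, mulVec_sub]
    abel
  rw [hsub, mulVec_neg, neg_dotProduct_neg, dotProduct_errorWeight_mulVec,
    mulVec_mulVec _ (controlWeight B R P), mul_nonsing_inv _ hu, one_mulVec, dotProduct_comm]

end RiccatiStep

/-! ### The noise and the estimate of its mean -/

section RandomVectors

variable {ι κ Ω : Type*} [Fintype ι] [Fintype κ] [MeasurableSpace Ω] {μ : Measure Ω}

omit [Fintype κ] in
theorem measurable_mulVec (M : Matrix κ ι ℝ) : Measurable fun x : ι → ℝ => M *ᵥ x := by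
  unfold mulVec dotProduct
  fun_prop

theorem memLp_mulVec (M : Matrix κ ι ℝ) {q : ENNReal} {x : Ω → ι → ℝ} (hx : MemLp x q μ) :
    MemLp (fun ω => M *ᵥ x ω) q μ :=
  (mulVecLin M).toContinuousLinearMap.comp_memLp' hx

theorem integral_mulVec (M : Matrix κ ι ℝ) {x : Ω → ι → ℝ} (hx : Integrable x μ) :
    ∫ ω, M *ᵥ x ω ∂μ = M *ᵥ ∫ ω, x ω ∂μ :=
  (mulVecLin M).toContinuousLinearMap.integral_comp_comm hx

theorem integrable_dotProduct {x y : Ω → ι → ℝ} (hx : MemLp x 2 μ) (hy : MemLp y 2 μ) :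
    Integrable (fun ω => x ω ⬝ᵥ y ω) μ :=
  integrable_finsetSum _ fun i _ => (memLp_pi_iff.1 hx i).integrable_mul (memLp_pi_iff.1 hy i)

theorem integrable_quadFn [IsFiniteMeasure μ] (P : Matrix ι ι ℝ) (g : ι → ℝ) {x : Ω → ι → ℝ}
    (hx : MemLp x 2 μ) : Integrable (fun ω => quadFn P g (x ω)) μ :=
  (integrable_dotProduct hx (memLp_mulVec P hx)).add
    ((integrable_dotProduct hx (memLp_const g)).const_mul 2)

theorem integral_dotProduct_of_indepFun {x y : Ω → ι → ℝ} (hxy : IndepFun x y μ)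
    (hx : Integrable x μ) (hy : Integrable y μ) :
    ∫ ω, x ω ⬝ᵥ y ω ∂μ = (∫ ω, x ω ∂μ) ⬝ᵥ ∫ ω, y ω ∂μ := by
  have hcoord (i : ι) : IndepFun (fun ω => x ω i) (fun ω => y ω i) μ :=
    hxy.comp (measurable_pi_apply i) (measurable_pi_apply i)
  have hint (i : ι) : Integrable (fun ω => x ω i * y ω i) μ :=
    (hcoord i).integrable_mul (hx.eval i) (hy.eval i)
  simp only [dotProduct]
  rw [integral_finsetSum _ fun i _ => hint i]
  refine Finset.sum_congr rfl fun i _ => ?_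
  rw [eval_integral fun i => hx.eval i, eval_integral fun i => hy.eval i]
  exact (hcoord i).integral_fun_mul_eq_mul_integral (hx.eval i).1 (hy.eval i).1

theorem integral_sampleMean_sub_sq_le [IsProbabilityMeasure μ] {X : ℕ → Ω → ℝ} {m V : ℝ}
    (hX : ∀ i, MemLp (X i) 2 μ) (hind : Pairwise fun i j => IndepFun (X i) (X j) μ)
    (hm : ∀ i, ∫ ω, X i ω ∂μ = m) (hV : ∀ i, Var[X i; μ] ≤ V) {t : ℕ} (ht : t ≠ 0) :
    ∫ ω, ((t : ℝ)⁻¹ * ∑ i ∈ Finset.range t, X i ω - m) ^ 2 ∂μ ≤ V * (1 / (t : ℝ)) := by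
  set S : Ω → ℝ := ∑ i ∈ Finset.range t, X i with hS
  have hSmem : MemLp S 2 μ := memLp_finsetSum' _ fun i _ => hX i
  have hSmean : ∫ ω, (t : ℝ)⁻¹ * S ω ∂μ = m := by
    simp only [hS, Finset.sum_apply]
    rw [integral_const_mul, integral_finsetSum _ fun i _ => (hX i).integrable one_le_two]
    simp only [hm, Finset.sum_const, Finset.card_range, nsmul_eq_mul]
    field_simp
  have hSvar : Var[S; μ] ≤ t * V := by
    rw [hS, IndepFun.variance_sum (fun i _ => hX i) fun i _ j _ hij => hind hij]
    simpa using Finset.sum_le_card_nsmul (Finset.range t) (fun i => Var[X i; μ]) V fun i _ => hV i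
  calc ∫ ω, ((t : ℝ)⁻¹ * ∑ i ∈ Finset.range t, X i ω - m) ^ 2 ∂μ
      = Var[fun ω => (t : ℝ)⁻¹ * S ω; μ] := by
        rw [variance_eq_integral (hSmem.aemeasurable.const_mul _), hSmean]
        simp only [hS, Finset.sum_apply]
    _ = ((t : ℝ)⁻¹) ^ 2 * Var[S; μ] := variance_const_mul _ _ _
    _ ≤ ((t : ℝ)⁻¹) ^ 2 * (t * V) := by gcongr
    _ = V * (1 / (t : ℝ)) := by field_simp

variable [DecidableEq κ] [IsProbabilityMeasure μ]

theorem integral_stage_cost_add_noise_eq {A : Matrix ι ι ℝ} {B : Matrix ι κ ℝ}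
    {Q : Matrix ι ι ℝ} {R : Matrix κ κ ℝ} {P : Matrix ι ι ℝ} (hR : R.PosDef) (hP : P.PosSemidef)
    (L : Matrix ι ι ℝ) (e : ι → ℝ) {x d : Ω → ι → ℝ} {u : Ω → κ → ℝ} (hx : MemLp x 2 μ)
    (hu : MemLp u 2 μ) (hd : MemLp d 2 μ)
    (hf : MemLp (fun ω => optimalControl A B R P ((P + L) *ᵥ e) (x ω)) 2 μ)
    (hcross : ∫ ω, (A *ᵥ x ω + B *ᵥ u ω) ⬝ᵥ P *ᵥ (d ω - e) ∂μ = 0) :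
    ∫ ω, (x ω ⬝ᵥ Q *ᵥ x ω + u ω ⬝ᵥ R *ᵥ u ω) ∂μ
        + ∫ ω, quadFn P (L *ᵥ e) (A *ᵥ x ω + B *ᵥ u ω + d ω) ∂μ
      = ∫ ω, quadFn (riccatiStep A B Q R P) (adjointStep A B R P L *ᵥ e) (x ω) ∂μ
        + ∫ ω, (u ω - optimalControl A B R P ((P + L) *ᵥ e) (x ω)) ⬝ᵥ
            controlWeight B R P *ᵥ (u ω - optimalControl A B R P ((P + L) *ᵥ e) (x ω)) ∂μ
        + (∫ ω, quadFn P (L *ᵥ e) (d ω) ∂μ - e ⬝ᵥ errorWeight B R P L *ᵥ e) := by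
  have hnext : MemLp (fun ω => A *ᵥ x ω + B *ᵥ u ω) 2 μ :=
    (memLp_mulVec A hx).add (memLp_mulVec B hu)
  have hstage := (integrable_dotProduct hx (memLp_mulVec Q hx)).add
    (integrable_dotProduct hu (memLp_mulVec R hu))
  have hgap := integrable_dotProduct (hu.sub hf) (memLp_mulVec (controlWeight B R P) (hu.sub hf))
  have hlin := (integrable_dotProduct hnext
    (memLp_mulVec P (hd.sub (memLp_const e)))).const_mul 2
  have hVx := integrable_quadFn (riccatiStep A B Q R P) (adjointStep A B R P L *ᵥ e) hx
  have hVd := integrable_quadFn P (L *ᵥ e) hd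
  have hpoint := congrArg (fun f : Ω → ℝ => ∫ ω, f ω ∂μ) (funext fun ω =>
    stage_cost_add_noise_eq (A := A) (B := B) (Q := Q) hR hP L e (d ω) (x ω) (u ω))
  refine (integral_add hstage (integrable_quadFn P (L *ᵥ e) (hnext.add hd))).symm.trans
    (hpoint.trans ?_)
  refine (integral_add ((hVx.add hgap).add hlin) (hVd.sub (integrable_const _))).trans ?_
  congr 1
  · refine (integral_add (hVx.add hgap) hlin).trans ?_
    rw [integral_const_mul]
    refine (congrArg₂ _ (integral_add hVx hgap) (congrArg _ hcross)).trans ?_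
    simp
  · refine (integral_sub hVd (integrable_const _)).trans ?_
    simp

end RandomVectors

section Noise

variable {n M : ℕ} {Ω : Type*} {v : Fin M → Fin n → ℝ} {p : Fin M → ℝ} {w : ℕ → Ω → Fin n → ℝ}

theorem measurable_history_apply {s t : ℕ} (h : s < t) : Measurable[history w t] (w s) :=
  measurable_iff_comap_le.2 <|
    le_iSup₂_of_le (f := fun s (_ : s < t) => MeasurableSpace.comap (w s) inferInstance) s h le_rfl

theorem meanEstimate_zero (ω : Ω) : meanEstimate v w 0 ω = 0 := by
  rw [meanEstimate, lmmsue, if_pos rfl, mulVec_zero]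

theorem measurable_obs {_ : MeasurableSpace Ω} {t : ℕ} (h : Measurable (w t)) :
    Measurable (obs v w t) :=
  measurable_pi_lambda _ fun j =>
    Measurable.ite (h (measurableSet_singleton (v j))) measurable_const measurable_const

theorem measurable_meanEstimate {_ : MeasurableSpace Ω} {t : ℕ} (h : ∀ s < t, Measurable (w s)) :
    Measurable (meanEstimate v w t) := by
  refine (measurable_mulVec _).comp ?_
  unfold lmmsue
  split_ifs
  · exact measurable_const
  · exact (Finset.measurable_fun_sum _ fun i hi =>
      measurable_obs (h i (Finset.mem_range.1 hi))).const_smul (1 / (t : ℝ))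

variable [MeasurableSpace Ω] {μ : Measure Ω}

namespace IsNoise

theorem measurableSet_eq (hw : IsNoise μ v p w) (t : ℕ) (j : Fin M) :
    MeasurableSet {ω | w t ω = v j} :=
  hw.measurable t (measurableSet_singleton (v j))

theorem indepFun_of_measurable_history {α : Type*} [MeasurableSpace α] (hw : IsNoise μ v p w)
    {t : ℕ} {z : Ω → α} (hz : Measurable[history w t] z) : IndepFun z (w t) μ := by
  have h := indep_iSup_of_disjoint (m := fun s => MeasurableSpace.comap (w s) inferInstance)
    (fun s => (hw.measurable s).comap_le) hw.indep (S := {s | s < t}) (T := {t}) (by simp)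
  rw [IndepFun_iff_Indep]
  exact indep_of_indep_of_le_left (by simpa using h) hz.comap_le

variable [IsProbabilityMeasure μ]

theorem ae_mem_range (hw : IsNoise μ v p w) (t : ℕ) : ∀ᵐ ω ∂μ, ∃ j, w t ω = v j := by
  have hreal : μ.real (⋃ j, {ω | w t ω = v j}) = 1 := by
    rw [measureReal_iUnion_fintype _ fun j => hw.measurableSet_eq t j]
    · simp only [hw.law, hw.sum_eq_one]
    · intro i j hij
      exact Set.disjoint_left.2 fun ω hi hj => hij (hw.distinct (hi.symm.trans hj))
  have hone : μ (⋃ j, {ω | w t ω = v j}) = 1 := (ENNReal.toReal_eq_one_iff _).1 hreal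
  filter_upwards [(mem_ae_iff_prob_eq_one
    (MeasurableSet.iUnion fun j => hw.measurableSet_eq t j)).2 hone] with ω hω
  exact Set.mem_iUnion.1 hω

theorem norm_ae_le (hw : IsNoise μ v p w) (t : ℕ) : ∀ᵐ ω ∂μ, ‖w t ω‖ ≤ ‖v‖ := by
  filter_upwards [hw.ae_mem_range t] with ω ⟨j, hj⟩
  exact hj ▸ norm_le_pi_norm v j

theorem memLp (hw : IsNoise μ v p w) (q : ENNReal) (t : ℕ) : MemLp (w t) q μ :=
  MemLp.of_bound (hw.measurable t).aestronglyMeasurable ‖v‖ (hw.norm_ae_le t)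

theorem integrable (hw : IsNoise μ v p w) (t : ℕ) : Integrable (w t) μ :=
  memLp_one_iff_integrable.1 (hw.memLp 1 t)

theorem mulVec_obs_ae_eq (hw : IsNoise μ v p w) (t : ℕ) :
    (fun ω => valueMatrix v *ᵥ obs v w t ω) =ᵐ[μ] w t := by
  filter_upwards [hw.ae_mem_range t] with ω ⟨j, hj⟩
  have hobs : obs v w t ω = Pi.single j 1 := by
    ext i
    simp [obs, hj, Pi.single_apply, hw.distinct.eq_iff, eq_comm]
  rw [hobs, mulVec_single_one, hj]
  rfl

theorem integral_eq (hw : IsNoise μ v p w) (t : ℕ) : ∫ ω, w t ω ∂μ = noiseMean v p := by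
  have hind (j : Fin M) : (fun ω => obs v w t ω j) = {ω | w t ω = v j}.indicator 1 := by
    classical
    ext ω
    simp [obs, Set.indicator_apply]
  have hint (j : Fin M) : Integrable (fun ω => obs v w t ω j) μ := by
    rw [hind]
    exact (integrable_const (1 : ℝ)).indicator (hw.measurableSet_eq t j)
  have hobs : ∫ ω, obs v w t ω ∂μ = p := by
    ext j
    rw [eval_integral hint, hind, integral_indicator_one (hw.measurableSet_eq t j), hw.law]
  rw [← integral_congr_ae (hw.mulVec_obs_ae_eq t), integral_mulVec _ (Integrable.of_eval hint),
    hobs, noiseMean]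

theorem integral_dotProduct_mulVec_sub_eq_zero (hw : IsNoise μ v p w)
    {k t : ℕ} (N : Matrix (Fin k) (Fin n) ℝ) {z : Ω → Fin k → ℝ} (hz : Measurable[history w t] z)
    (hzi : Integrable z μ) : ∫ ω, z ω ⬝ᵥ N *ᵥ (w t ω - noiseMean v p) ∂μ = 0 := by
  have hdev : Integrable (fun ω => w t ω - noiseMean v p) μ :=
    (hw.integrable t).sub (integrable_const _)
  have hind : IndepFun z (fun ω => N *ᵥ (w t ω - noiseMean v p)) μ :=
    (hw.indepFun_of_measurable_history hz).comp measurable_id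
      ((measurable_mulVec N).comp (measurable_id.sub_const (noiseMean v p)))
  rw [integral_dotProduct_of_indepFun hind hzi
      (memLp_one_iff_integrable.1 (memLp_mulVec N (memLp_one_iff_integrable.2 hdev))),
    integral_mulVec N hdev, integral_sub (hw.integrable t) (integrable_const _), hw.integral_eq]
  simp

theorem meanEstimate_ae_eq (hw : IsNoise μ v p w) (t : ℕ) :
    meanEstimate v w t =ᵐ[μ] fun ω => (t : ℝ)⁻¹ • ∑ i ∈ Finset.range t, w i ω := by
  rcases eq_or_ne t 0 with rfl | ht
  · exact .of_forall fun ω => by simp [meanEstimate_zero]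
  filter_upwards [ae_all_iff.2 hw.mulVec_obs_ae_eq] with ω hω
  simp only [meanEstimate, lmmsue, if_neg ht, mulVec_smul, mulVec_sum, hω, one_div]

theorem memLp_meanEstimate (hw : IsNoise μ v p w) (q : ENNReal) (t : ℕ) :
    MemLp (meanEstimate v w t) q μ :=
  (memLp_congr_ae (hw.meanEstimate_ae_eq t)).2
    ((memLp_finsetSum (Finset.range t) fun i _ => hw.memLp q i).const_smul (t : ℝ)⁻¹)

theorem variance_apply_le (hw : IsNoise μ v p w) (t : ℕ) (a : Fin n) :
    Var[fun ω => w t ω a; μ] ≤ ‖v‖ ^ 2 := by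
  have hbound : ∀ᵐ ω ∂μ, w t ω a ∈ Set.Icc (-‖v‖) ‖v‖ := by
    filter_upwards [hw.norm_ae_le t] with ω hω
    exact abs_le.1 ((norm_le_pi_norm (w t ω) a).trans hω)
  have h := variance_le_sq_of_bounded hbound
    ((measurable_pi_apply a).comp (hw.measurable t)).aemeasurable
  rwa [sub_neg_eq_add, add_self_div_two] at h

theorem integral_meanEstimate_sub_dotProduct_self_le (hw : IsNoise μ v p w) {t : ℕ}
    (ht : t ≠ 0) :
    ∫ ω, (meanEstimate v w t ω - noiseMean v p) ⬝ᵥ (meanEstimate v w t ω - noiseMean v p) ∂μ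
      ≤ n * ‖v‖ ^ 2 * (1 / (t : ℝ)) := by
  have hcoord (a : Fin n) :
      ∫ ω, (meanEstimate v w t ω a - noiseMean v p a) ^ 2 ∂μ ≤ ‖v‖ ^ 2 * (1 / (t : ℝ)) := by
    have hsample := integral_sampleMean_sub_sq_le (X := fun i ω => w i ω a)
      (fun i => memLp_pi_iff.1 (hw.memLp 2 i) a)
      (fun i j hij => (hw.indep.indepFun hij).comp (measurable_pi_apply a) (measurable_pi_apply a))
      (fun i => by rw [← eval_integral fun a => (hw.integrable i).eval a, hw.integral_eq])
      (fun i => hw.variance_apply_le i a) ht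
    refine le_of_eq_of_le (integral_congr_ae ?_) hsample
    filter_upwards [hw.meanEstimate_ae_eq t] with ω hω
    rw [hω, Pi.smul_apply, Finset.sum_apply, smul_eq_mul]
  have hsq (a : Fin n) : Integrable (fun ω => (meanEstimate v w t ω a - noiseMean v p a) ^ 2) μ :=
    (((memLp_pi_iff.1 (hw.memLp_meanEstimate 2 t)) a).sub (memLp_const _)).integrable_sq
  simp only [dotProduct, Pi.sub_apply, ← sq]
  rw [integral_finsetSum _ fun a _ => hsq a]
  simpa [mul_assoc] using Finset.sum_le_card_nsmul Finset.univ
    (fun a => ∫ ω, (meanEstimate v w t ω a - noiseMean v p a) ^ 2 ∂μ) _ fun a _ => hcoord a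

end IsNoise

end Noise

/-! ### The cost of an admissible control -/

section Cost

variable {n m : ℕ} {A : Matrix (Fin n) (Fin n) ℝ} {B : Matrix (Fin n) (Fin m) ℝ}
  {Q : ℕ → Matrix (Fin n) (Fin n) ℝ} {R : ℕ → Matrix (Fin m) (Fin m) ℝ}
  {S : Matrix (Fin n) (Fin n) ℝ} {T : ℕ}

theorem riccatiP_eq_riccatiStep {t : ℕ} (ht : t ≤ T) :
    riccatiP A B Q R S T t = riccatiStep A B (Q t) (R t) (riccatiP A B Q R S T (t + 1)) := by
  rw [riccatiP, riccatiP, Nat.add_sub_add_right, Nat.sub_add_comm ht, riccatiBack,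
    Nat.sub_sub_self ht]
  rfl

theorem posSemidef_riccatiBack (hQ : ∀ t, (Q t).PosSemidef) (hR : ∀ t, (R t).PosDef)
    (hS : S.PosSemidef) (k : ℕ) : (riccatiBack A B Q R S T k).PosSemidef := by
  induction k with
  | zero => exact hS
  | succ k ih => exact posSemidef_riccatiStep (hQ _) (hR _) ih

theorem adjointL_eq_adjointStep (hQ : ∀ t, (Q t).PosSemidef) (hR : ∀ t, (R t).PosDef)
    (hS : S.PosSemidef) {t : ℕ} (ht : t ≤ T) :
    adjointL A B Q R S T t
      = adjointStep A B (R t) (riccatiP A B Q R S T (t + 1)) (adjointL A B Q R S T (t + 1)) := by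
  have hP : (riccatiP A B Q R S T (t + 1)).IsSymm :=
    (posSemidef_real_iff.1 (posSemidef_riccatiBack hQ hR hS _)).1
  rw [adjointStep, closedLoop_transpose (posSemidef_real_iff.1 (hR t).posSemidef).1 hP, adjointL,
    Nat.sub_add_comm ht, adjointBack, Nat.sub_sub_self ht, riccatiP, adjointL,
    Nat.add_sub_add_right]
  rfl

theorem feedback_eq_optimalControl (t : ℕ) (x e : Fin n → ℝ) :
    feedback A B Q R S T t x e = optimalControl A B (R t) (riccatiP A B Q R S T (t + 1))
      ((riccatiP A B Q R S T (t + 1) + adjointL A B Q R S T (t + 1)) *ᵥ e) x := by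
  simp only [feedback, optimalControl, upsilon, controlWeight, mulVec_mulVec, mulVec_add,
    Matrix.mul_assoc, add_mulVec, add_assoc]

variable {Ω : Type*} {x₀ : Fin n → ℝ} {w : ℕ → Ω → Fin n → ℝ} {u : ℕ → Ω → Fin m → ℝ}

theorem state_onlinePolicy {M : ℕ} (v : Fin M → Fin n → ℝ) (t : ℕ) :
    state A B x₀ w (onlinePolicy A B Q R S T x₀ w v) t = onlineState A B Q R S T x₀ w v t := by
  induction t with
  | zero => rfl
  | succ t ih =>
    rw [state, ih]
    rfl

theorem onlinePolicy_eq {M : ℕ} (v : Fin M → Fin n → ℝ) (t : ℕ) :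
    onlinePolicy A B Q R S T x₀ w v t = fun ω => feedback A B Q R S T t
      (state A B x₀ w (onlinePolicy A B Q R S T x₀ w v) t ω) (meanEstimate v w t ω) := by
  rw [state_onlinePolicy]
  rfl

theorem history_mono {s t : ℕ} (h : s ≤ t) : history w s ≤ history w t :=
  iSup₂_mono' fun r hr => ⟨r, hr.trans_le h, le_rfl⟩

theorem measurable_feedback {_ : MeasurableSpace Ω} (t : ℕ) {x e : Ω → Fin n → ℝ}
    (hx : Measurable x) (he : Measurable e) :
    Measurable fun ω => feedback A B Q R S T t (x ω) (e ω) :=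
  ((measurable_mulVec _).comp ((((measurable_mulVec _).comp hx).add
    ((measurable_mulVec _).comp he)).add ((measurable_mulVec _).comp he))).neg

theorem measurable_state {_ : MeasurableSpace Ω} {t : ℕ} (hw : ∀ s < t, Measurable (w s))
    (hu : ∀ s < t, Measurable (u s)) : Measurable (state A B x₀ w u t) := by
  induction t with
  | zero => exact measurable_const
  | succ t ih =>
    have hx := ih (fun s hs => hw s (hs.trans t.lt_succ_self)) fun s hs =>
      hu s (hs.trans t.lt_succ_self)
    exact (((measurable_mulVec A).comp hx).add
      ((measurable_mulVec B).comp (hu t t.lt_succ_self))).add (hw t t.lt_succ_self)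

variable [MeasurableSpace Ω] {μ : Measure Ω}

theorem memLp_feedback (t : ℕ) {q : ENNReal} {x e : Ω → Fin n → ℝ} (hx : MemLp x q μ)
    (he : MemLp e q μ) : MemLp (fun ω => feedback A B Q R S T t (x ω) (e ω)) q μ := by
  have hsum := ((memLp_mulVec (Bᵀ * riccatiP A B Q R S T (t + 1) * A) hx).add
    (memLp_mulVec (Bᵀ * riccatiP A B Q R S T (t + 1)) he)).add
    (memLp_mulVec (Bᵀ * adjointL A B Q R S T (t + 1)) he)
  exact (memLp_mulVec (upsilon A B Q R S T t)⁻¹ hsum).neg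

theorem memLp_state [IsFiniteMeasure μ] {q : ENNReal} {t : ℕ} (hw : ∀ s < t, MemLp (w s) q μ)
    (hu : ∀ s < t, MemLp (u s) q μ) : MemLp (state A B x₀ w u t) q μ := by
  induction t with
  | zero => exact memLp_const x₀
  | succ t ih =>
    have hx := ih (fun s hs => hw s (hs.trans t.lt_succ_self)) fun s hs =>
      hu s (hs.trans t.lt_succ_self)
    exact ((memLp_mulVec A hx).add (memLp_mulVec B (hu t t.lt_succ_self))).add
      (hw t t.lt_succ_self)

theorem Admissible.measurable_state (hu : Admissible w μ u) (t : ℕ) :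
    Measurable[history w t] (state A B x₀ w u t) :=
  OnlineLQ.measurable_state (fun _ hs => measurable_history_apply hs) fun s hs =>
    (hu s).1.mono (history_mono hs.le) le_rfl

variable (A B Q R S T x₀ w μ) in
/-- The expected loss at time `t` that the control `u` incurs by deviating from the feedback law
for noise of mean `e`. -/
noncomputable def deviationCost (u : ℕ → Ω → Fin m → ℝ) (e : Fin n → ℝ) (t : ℕ) : ℝ :=
  ∫ ω, (u t ω - feedback A B Q R S T t (state A B x₀ w u t ω) e) ⬝ᵥ
    upsilon A B Q R S T t *ᵥ (u t ω - feedback A B Q R S T t (state A B x₀ w u t ω) e) ∂μ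

variable (A B Q R S T w μ) in
/-- The contribution of the noise at time `t`, of mean `e`, to the optimal cost: it does not depend
on the state or the control. -/
noncomputable def noiseCost (e : Fin n → ℝ) (t : ℕ) : ℝ :=
  ∫ ω, quadFn (riccatiP A B Q R S T (t + 1)) (adjointL A B Q R S T (t + 1) *ᵥ e) (w t ω) ∂μ
    - e ⬝ᵥ matD A B Q R S T t *ᵥ e

variable (A B Q R S T x₀ w μ) in
/-- The cost of the feedback law for noise of mean `e` when this mean is known. -/
noncomputable def knownMeanCost (e : Fin n → ℝ) : ℝ :=
  quadFn (riccatiP A B Q R S T 0) (adjointL A B Q R S T 0 *ᵥ e) x₀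
    + ∑ t ∈ Finset.range (T + 1), noiseCost A B Q R S T w μ e t

variable [IsProbabilityMeasure μ] {M : ℕ} {v : Fin M → Fin n → ℝ} {p : Fin M → ℝ}

theorem admissible_onlinePolicy (hw : IsNoise μ v p w) :
    Admissible w μ (onlinePolicy A B Q R S T x₀ w v) := by
  intro t
  induction t using Nat.strong_induction_on with
  | _ t ih =>
    rw [onlinePolicy_eq]
    constructor
    · exact measurable_feedback t
        (measurable_state (fun s hs => measurable_history_apply hs) fun s hs =>
          (ih s hs).1.mono (history_mono hs.le) le_rfl)
        (measurable_meanEstimate fun s hs => measurable_history_apply hs)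
    · exact memLp_feedback t (memLp_state (fun s _ => hw.memLp 2 s) fun s hs => (ih s hs).2)
        (hw.memLp_meanEstimate 2 t)

theorem Admissible.memLp_state (hu : Admissible w μ u) (hw : IsNoise μ v p w) (t : ℕ) :
    MemLp (state A B x₀ w u t) 2 μ :=
  OnlineLQ.memLp_state (fun s _ => hw.memLp 2 s) fun s _ => (hu s).2

-- The conditional expectation of the cross term with the noise vanishes, since `w t` is
-- independent of the state and of the control at time `t`.
theorem integral_stage_cost_add_eq (hQ : ∀ t, (Q t).PosSemidef) (hR : ∀ t, (R t).PosDef)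
    (hS : S.PosSemidef) (hw : IsNoise μ v p w) (hu : Admissible w μ u) {t : ℕ} (ht : t ≤ T) :
    ∫ ω, (state A B x₀ w u t ω ⬝ᵥ Q t *ᵥ state A B x₀ w u t ω + u t ω ⬝ᵥ R t *ᵥ u t ω) ∂μ
        + ∫ ω, quadFn (riccatiP A B Q R S T (t + 1))
            (adjointL A B Q R S T (t + 1) *ᵥ noiseMean v p) (state A B x₀ w u (t + 1) ω) ∂μ
      = ∫ ω, quadFn (riccatiP A B Q R S T t) (adjointL A B Q R S T t *ᵥ noiseMean v p)
            (state A B x₀ w u t ω) ∂μ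
        + deviationCost A B Q R S T x₀ w μ u (noiseMean v p) t
        + noiseCost A B Q R S T w μ (noiseMean v p) t := by
  have hx := hu.memLp_state (A := A) (B := B) (x₀ := x₀) hw
  have hnext : MemLp (fun ω => A *ᵥ state A B x₀ w u t ω + B *ᵥ u t ω) 2 μ :=
    (memLp_mulVec A (hx t)).add (memLp_mulVec B (hu t).2)
  have hnext_meas : Measurable[history w t] fun ω => A *ᵥ state A B x₀ w u t ω + B *ᵥ u t ω :=
    ((measurable_mulVec A).comp (hu.measurable_state t)).add ((measurable_mulVec B).comp (hu t).1)
  have hf : MemLp (fun ω => feedback A B Q R S T t (state A B x₀ w u t ω) (noiseMean v p)) 2 μ :=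
    memLp_feedback t (hx t) (memLp_const _)
  simp only [feedback_eq_optimalControl] at hf
  simp only [deviationCost, noiseCost, riccatiP_eq_riccatiStep ht,
    adjointL_eq_adjointStep hQ hR hS ht, feedback_eq_optimalControl, add_assoc]
  rw [← add_assoc]
  exact integral_stage_cost_add_noise_eq (hR t) (posSemidef_riccatiBack hQ hR hS _) _ _ (hx t)
    (hu t).2 (hw.memLp 2 t) hf
    (hw.integral_dotProduct_mulVec_sub_eq_zero _ hnext_meas (hnext.integrable one_le_two))

theorem cost_eq_knownMeanCost_add (hQ : ∀ t, (Q t).PosSemidef) (hR : ∀ t, (R t).PosDef)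
    (hS : S.PosSemidef) (hw : IsNoise μ v p w) (hu : Admissible w μ u) :
    cost A B Q R S T x₀ w μ u = knownMeanCost A B Q R S T x₀ w μ (noiseMean v p)
      + ∑ t ∈ Finset.range (T + 1), deviationCost A B Q R S T x₀ w μ u (noiseMean v p) t := by
  let Φ (t : ℕ) : ℝ := ∫ ω, quadFn (riccatiP A B Q R S T t)
    (adjointL A B Q R S T t *ᵥ noiseMean v p) (state A B x₀ w u t ω) ∂μ
  have hstart : Φ 0
      = quadFn (riccatiP A B Q R S T 0) (adjointL A B Q R S T 0 *ᵥ noiseMean v p) x₀ := by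
    simp only [Φ, state, integral_const, probReal_univ, one_smul]
  have hend : Φ (T + 1)
      = ∫ ω, state A B x₀ w u (T + 1) ω ⬝ᵥ S *ᵥ state A B x₀ w u (T + 1) ω ∂μ := by
    simp only [Φ, riccatiP, adjointL, Nat.sub_self, riccatiBack, adjointBack, zero_mulVec,
      quadFn_zero_right]
  have hstep (t : ℕ) (ht : t ∈ Finset.range (T + 1)) :
      ∫ ω, (state A B x₀ w u t ω ⬝ᵥ Q t *ᵥ state A B x₀ w u t ω + u t ω ⬝ᵥ R t *ᵥ u t ω) ∂μ
        = Φ t - Φ (t + 1) + (deviationCost A B Q R S T x₀ w μ u (noiseMean v p) t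
          + noiseCost A B Q R S T w μ (noiseMean v p) t) := by
    have := integral_stage_cost_add_eq (A := A) (B := B) (x₀ := x₀) hQ hR hS hw hu
      (Nat.lt_succ_iff.1 (Finset.mem_range.1 ht))
    simp only [Φ]
    linarith
  rw [cost, Finset.sum_congr rfl hstep, Finset.sum_add_distrib, Finset.sum_add_distrib,
    Finset.sum_range_sub', hstart, hend, knownMeanCost]
  ring

theorem knownMeanCost_le_cost (hQ : ∀ t, (Q t).PosSemidef) (hR : ∀ t, (R t).PosDef)
    (hS : S.PosSemidef) (hw : IsNoise μ v p w) (hu : Admissible w μ u) :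
    knownMeanCost A B Q R S T x₀ w μ (noiseMean v p) ≤ cost A B Q R S T x₀ w μ u := by
  rw [cost_eq_knownMeanCost_add hQ hR hS hw hu]
  have hΥ (t : ℕ) : (upsilon A B Q R S T t).PosSemidef :=
    (posDef_controlWeight B (hR t) (posSemidef_riccatiBack hQ hR hS _)).posSemidef
  exact le_add_of_nonneg_right (Finset.sum_nonneg fun t _ => integral_nonneg fun ω =>
    (posSemidef_real_iff.1 (hΥ t)).2 _)

theorem knownMeanCost_le_optimalCost (hQ : ∀ t, (Q t).PosSemidef) (hR : ∀ t, (R t).PosDef)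
    (hS : S.PosSemidef) (hw : IsNoise μ v p w) :
    knownMeanCost A B Q R S T x₀ w μ (noiseMean v p) ≤ optimalCost A B Q R S T x₀ w μ := by
  refine le_csInf ⟨_, _, admissible_onlinePolicy (A := A) (B := B) (Q := Q) (R := R) (S := S)
    (T := T) (x₀ := x₀) hw, rfl⟩ ?_
  rintro _ ⟨u, hu, rfl⟩
  exact knownMeanCost_le_cost hQ hR hS hw hu

theorem regret_nonneg (hQ : ∀ t, (Q t).PosSemidef) (hR : ∀ t, (R t).PosDef)
    (hS : S.PosSemidef) (hw : IsNoise μ v p w) : 0 ≤ regret A B Q R S T x₀ w μ v := by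
  refine sub_nonneg.2 (csInf_le ⟨knownMeanCost A B Q R S T x₀ w μ (noiseMean v p), ?_⟩
    ⟨_, admissible_onlinePolicy hw, rfl⟩)
  rintro _ ⟨u, hu, rfl⟩
  exact knownMeanCost_le_cost hQ hR hS hw hu

omit [IsProbabilityMeasure μ] in
theorem deviationCost_onlinePolicy (hQ : ∀ t, (Q t).PosSemidef) (hR : ∀ t, (R t).PosDef)
    (hS : S.PosSemidef) (v : Fin M → Fin n → ℝ) (e : Fin n → ℝ) (t : ℕ) :
    deviationCost A B Q R S T x₀ w μ (onlinePolicy A B Q R S T x₀ w v) e t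
      = ∫ ω, (meanEstimate v w t ω - e) ⬝ᵥ
          matD A B Q R S T t *ᵥ (meanEstimate v w t ω - e) ∂μ := by
  rw [deviationCost]
  conv_lhs => rw [onlinePolicy_eq]
  simp only [state_onlinePolicy, feedback_eq_optimalControl]
  exact integral_congr_ae (.of_forall fun ω => optimalControl_sub_dotProduct_mulVec (hR t)
    (posSemidef_riccatiBack hQ hR hS _) _ _ _ _)

theorem regret_le_sum_integral (hQ : ∀ t, (Q t).PosSemidef) (hR : ∀ t, (R t).PosDef)
    (hS : S.PosSemidef) (hw : IsNoise μ v p w) :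
    regret A B Q R S T x₀ w μ v
      ≤ ∑ t ∈ Finset.range (T + 1), ∫ ω, (meanEstimate v w t ω - noiseMean v p) ⬝ᵥ
          matD A B Q R S T t *ᵥ (meanEstimate v w t ω - noiseMean v p) ∂μ := by
  have hcost := cost_eq_knownMeanCost_add (A := A) (B := B) (T := T) (x₀ := x₀) hQ hR hS hw
    (admissible_onlinePolicy hw (A := A) (B := B) (Q := Q) (R := R) (S := S) (T := T) (x₀ := x₀))
  simp only [deviationCost_onlinePolicy hQ hR hS v] at hcost
  have hopt := knownMeanCost_le_optimalCost (A := A) (B := B) (T := T) (x₀ := x₀) hQ hR hS hw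
  rw [regret, hcost]
  linarith

theorem trace_mul_vecMulVec_self {ι α : Type*} [Fintype ι] [CommSemiring α] (D : Matrix ι ι α)
    (x : ι → α) : (D * vecMulVec x x).trace = x ⬝ᵥ D *ᵥ x := by
  rw [mul_vecMulVec, trace_vecMulVec, dotProduct_comm]

theorem integral_meanEstimate_sub_dotProduct_mulVec_le (hw : IsNoise μ v p w)
    {D : Matrix (Fin n) (Fin n) ℝ} {C : ℝ} (hC : 0 ≤ C)
    (hD : ∀ x, x ⬝ᵥ D *ᵥ x ≤ C * (x ⬝ᵥ x)) {t : ℕ} (ht : t ≠ 0) :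
    ∫ ω, (meanEstimate v w t ω - noiseMean v p) ⬝ᵥ
        D *ᵥ (meanEstimate v w t ω - noiseMean v p) ∂μ
      ≤ C * (n * ‖v‖ ^ 2) * (1 / (t : ℝ)) := by
  have herr : MemLp (fun ω => meanEstimate v w t ω - noiseMean v p) 2 μ :=
    (hw.memLp_meanEstimate 2 t).sub (memLp_const _)
  have hle := integral_mono (integrable_dotProduct herr (memLp_mulVec D herr))
    ((integrable_dotProduct herr herr).const_mul C) fun ω => hD _
  rw [integral_const_mul] at hle
  rw [mul_assoc]
  exact hle.trans
    (mul_le_mul_of_nonneg_left (hw.integral_meanEstimate_sub_dotProduct_self_le ht) hC)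

theorem regret_le_trace_add (hQ : ∀ t, (Q t).PosSemidef) (hR : ∀ t, (R t).PosDef)
    (hS : S.PosSemidef) (hw : IsNoise μ v p w) {C : ℝ} (hC : 0 ≤ C)
    (hD : ∀ t x, x ⬝ᵥ matD A B Q R S T t *ᵥ x ≤ C * (x ⬝ᵥ x)) :
    regret A B Q R S T x₀ w μ v
      ≤ (matD A B Q R S T 0 * vecMulVec (noiseMean v p) (noiseMean v p)).trace
        + C * (n * ‖v‖ ^ 2) * ∑ t ∈ Finset.Icc 1 T, 1 / (t : ℝ) := by
  refine (regret_le_sum_integral hQ hR hS hw).trans ?_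
  rw [Finset.range_eq_Ico, Finset.sum_eq_sum_Ico_succ_bot T.succ_pos, Finset.mul_sum]
  refine add_le_add (le_of_eq ?_) (Finset.sum_le_sum fun t ht =>
    integral_meanEstimate_sub_dotProduct_mulVec_le hw hC (hD t)
      (Nat.one_le_iff_ne_zero.1 (Finset.mem_Icc.1 ht).1))
  simp only [meanEstimate_zero, zero_sub, mulVec_neg, neg_dotProduct_neg, integral_const,
    probReal_univ, one_smul, trace_mul_vecMulVec_self]

end Cost

/-! ### Uniform bounds for time-invariant weights -/

section Stability

variable {ι : Type*} [Fintype ι] [DecidableEq ι]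

open scoped Matrix.Norms.L2Operator

omit [DecidableEq ι] in
theorem tendsto_zero_of_forall_tendsto_mulVec {κ : Type*} {F : ℕ → Matrix κ ι ℝ}
    (hF : ∀ x, Tendsto (fun t => F t *ᵥ x) atTop (𝓝 0)) : Tendsto F atTop (𝓝 0) := by
  classical
  refine tendsto_pi_nhds.2 fun i => tendsto_pi_nhds.2 fun j => ?_
  simpa only [mulVec_single_one, col_apply, Pi.zero_apply, Matrix.zero_apply] using
    tendsto_pi_nhds.1 (hF (Pi.single j 1)) i

theorem sum_range_pow_mulVec_dotProduct_self {α : Type*} [CommRing α] (F : Matrix ι ι α) (s : ℕ)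
    (x : ι → α) :
    ∑ i ∈ Finset.range s, ((F ^ i) *ᵥ F *ᵥ x) ⬝ᵥ ((F ^ i) *ᵥ F *ᵥ x)
      = ∑ i ∈ Finset.range s, ((F ^ i) *ᵥ x) ⬝ᵥ ((F ^ i) *ᵥ x)
        + ((F ^ s) *ᵥ x) ⬝ᵥ ((F ^ s) *ᵥ x) - x ⬝ᵥ x := by
  simp only [mulVec_mulVec, ← pow_succ]
  rw [← Finset.sum_range_succ, Finset.sum_range_succ', pow_zero, one_mulVec, add_sub_cancel_right]

-- If `‖F ^ s‖² ≤ 1/2`, the finite sum `2 ∑_{i<s} (Fⁱ)'Fⁱ` already is a solution.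
theorem exists_lyapunov {F : Matrix ι ι ℝ}
    (hF : ∀ x, Tendsto (fun t : ℕ => (F ^ t) *ᵥ x) atTop (𝓝 0)) :
    ∃ H : Matrix ι ι ℝ, H.PosSemidef ∧
      ∀ x, x ⬝ᵥ x + (F *ᵥ x) ⬝ᵥ H *ᵥ F *ᵥ x ≤ x ⬝ᵥ H *ᵥ x := by
  have hnorm : Tendsto (fun t : ℕ => ‖F ^ t‖ ^ 2) atTop (𝓝 0) := by
    simpa using (tendsto_zero_of_forall_tendsto_mulVec hF).norm.pow 2
  obtain ⟨s, hs⟩ := (hnorm.eventually (gt_mem_nhds one_half_pos)).exists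
  have hform (x : ι → ℝ) :
      x ⬝ᵥ ((2 : ℝ) • ∑ i ∈ Finset.range s, (F ^ i)ᵀ * F ^ i) *ᵥ x
        = 2 * ∑ i ∈ Finset.range s, ((F ^ i) *ᵥ x) ⬝ᵥ ((F ^ i) *ᵥ x) := by
    simp only [smul_mulVec, dotProduct_smul, sum_mulVec, dotProduct_sum,
      dotProduct_transpose_mul_mulVec, smul_eq_mul]
  refine ⟨(2 : ℝ) • ∑ i ∈ Finset.range s, (F ^ i)ᵀ * F ^ i, ?_, fun x => ?_⟩
  · refine (posSemidef_sum _ fun i _ => ?_).smul zero_le_two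
    simpa only [conjTranspose_eq_transpose_of_trivial] using
      posSemidef_conjTranspose_mul_self (F ^ i)
  · have hhalf := (mulVec_dotProduct_self_le (F ^ s) x).trans
      (mul_le_mul_of_nonneg_right hs.le (dotProduct_self_star_nonneg x))
    rw [hform, hform, sum_range_pow_mulVec_dotProduct_self]
    linarith

theorem le_mul_of_contraction {X : Type*} {g : ℕ → X → ℝ} (hg : ∀ j x, 0 ≤ g j x)
    {Φ : ℕ → X → X} {ρ : ℝ} (hρ : ρ < 1) (hcontr : ∀ j x, g j (Φ j x) ≤ ρ * g (j + 1) x)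
    {f : ℕ → X → ℝ} {b p : ℝ} (hb : 0 ≤ b) (hp : 0 ≤ p) (hzero : ∀ x, f 0 x ≤ b * g 0 x)
    (hsucc : ∀ j x, f (j + 1) x ≤ f j (Φ j x) + p * g j (Φ j x)) (j : ℕ) (x : X) :
    f j x ≤ (b + p / (1 - ρ)) * g j x := by
  have hρ' : 0 < 1 - ρ := sub_pos.2 hρ
  set c := b + p / (1 - ρ)
  have hbc : b ≤ c := le_add_of_nonneg_right (by positivity)
  have hcp : 0 ≤ c + p := by positivity
  have hcρ : (c + p) * ρ ≤ c := by
    have hc_mul : c * (1 - ρ) = b * (1 - ρ) + p := by rw [add_mul, div_mul_cancel₀ _ hρ'.ne']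
    have := mul_nonneg hb hρ'.le
    have := mul_nonneg hp hρ'.le
    linarith
  induction j generalizing x with
  | zero => exact (hzero x).trans (mul_le_mul_of_nonneg_right hbc (hg 0 x))
  | succ j ih =>
    calc f (j + 1) x ≤ c * g j (Φ j x) + p * g j (Φ j x) :=
          (hsucc j x).trans (add_le_add_left (ih _) _)
      _ = (c + p) * g j (Φ j x) := by ring
      _ ≤ (c + p) * (ρ * g (j + 1) x) := mul_le_mul_of_nonneg_left (hcontr j x) hcp
      _ = (c + p) * ρ * g (j + 1) x := by ring
      _ ≤ c * g (j + 1) x := mul_le_mul_of_nonneg_right hcρ (hg _ x)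

theorem exists_le_mul_of_lyapunov {X : Type*} {ν : X → ℝ} (hν : ∀ x, 0 ≤ ν x)
    {Y : ℕ → X → ℝ} {Φ : ℕ → X → X} {β : ℝ} (hβ : 0 < β) (hlow : ∀ j x, ν x ^ 2 ≤ Y j x)
    (hup : ∀ j x, Y j x ≤ β * ν x ^ 2) (hdec : ∀ j x, Y j (Φ j x) + ν x ^ 2 ≤ Y (j + 1) x)
    {f : ℕ → X → ℝ} {b p : ℝ} (hb : 0 ≤ b) (hp : 0 ≤ p) (hzero : ∀ x, f 0 x ≤ b * ν x)
    (hsucc : ∀ j x, f (j + 1) x ≤ f j (Φ j x) + p * ν (Φ j x)) :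
    ∃ c, 0 ≤ c ∧ ∀ j x, f j x ≤ c * ν x := by
  have hρ : √(1 - 1 / β) < 1 := (Real.sqrt_lt' one_pos).2 (by simpa using hβ)
  have hcontr (j : ℕ) (x : X) : √(Y j (Φ j x)) ≤ √(1 - 1 / β) * √(Y (j + 1) x) := by
    rw [← Real.sqrt_mul' _ ((sq_nonneg _).trans (hlow _ x))]
    refine Real.sqrt_le_sqrt ?_
    have hdiv : 1 / β * Y (j + 1) x ≤ ν x ^ 2 := by
      rw [one_div_mul_eq_div, div_le_iff₀' hβ]
      exact hup _ x
    linarith [hdec j x]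
  have hle_sqrt (j : ℕ) (x : X) : ν x ≤ √(Y j x) := Real.le_sqrt_of_sq_le (hlow j x)
  have hf (j : ℕ) (x : X) : f j x ≤ (b + p / (1 - √(1 - 1 / β))) * √(Y j x) :=
    le_mul_of_contraction (fun _ _ => Real.sqrt_nonneg _) hρ hcontr hb hp
      (fun x => (hzero x).trans (mul_le_mul_of_nonneg_left (hle_sqrt 0 x) hb))
      (fun j x => (hsucc j x).trans
        (add_le_add_right (mul_le_mul_of_nonneg_left (hle_sqrt j _) hp) _)) j x
  have hsqrt (j : ℕ) (x : X) : √(Y j x) ≤ √β * ν x := by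
    rw [← Real.sqrt_sq (hν x), ← Real.sqrt_mul hβ.le]
    exact Real.sqrt_le_sqrt (hup j x)
  have hc : 0 ≤ b + p / (1 - √(1 - 1 / β)) := add_nonneg hb (div_nonneg hp (sub_pos.2 hρ).le)
  refine ⟨(b + p / (1 - √(1 - 1 / β))) * √β, by positivity, fun j x => (hf j x).trans ?_⟩
  rw [mul_assoc]
  exact mul_le_mul_of_nonneg_left (hsqrt j x) hc

end Stability

section Iterates

variable {ι κ : Type*} [Fintype ι] [Fintype κ] [DecidableEq κ] (A : Matrix ι ι ℝ)
  (B : Matrix ι κ ℝ) (Q : Matrix ι ι ℝ) (R : Matrix κ κ ℝ)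

/-- The `k`-th Riccati iterate from the terminal weight `0`: the quadratic form of the optimal
cost of the noiseless problem with `k` stages. -/
noncomputable def riccatiIterate : ℕ → Matrix ι ι ℝ
  | 0 => 0
  | k + 1 => riccatiStep A B Q R (riccatiIterate k)

/-- The `k`-th iterate of the adjoint recursion along the Riccati iterates. -/
noncomputable def adjointIterate : ℕ → Matrix ι ι ℝ
  | 0 => 0
  | k + 1 => adjointStep A B R (riccatiIterate A B Q R k) (adjointIterate k)

variable {A B Q R}

theorem posSemidef_riccatiIterate (hQ : Q.PosSemidef) (hR : R.PosDef) (k : ℕ) :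
    (riccatiIterate A B Q R k).PosSemidef := by
  induction k with
  | zero => exact .zero
  | succ k ih => exact posSemidef_riccatiStep hQ hR ih

theorem dotProduct_riccatiIterate_mulVec_nonneg (hQ : Q.PosSemidef) (hR : R.PosDef) (k : ℕ)
    (x : ι → ℝ) : 0 ≤ x ⬝ᵥ riccatiIterate A B Q R k *ᵥ x :=
  (posSemidef_real_iff.1 (posSemidef_riccatiIterate hQ hR k)).2 x

theorem dotProduct_riccatiIterate_mulVec_le_of_lyapunov (hQ : Q.PosSemidef) (hR : R.PosDef)
    {K : Matrix κ ι ℝ} {V : (ι → ℝ) → ℝ} (hV : ∀ x, 0 ≤ V x)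
    (hK : ∀ x, x ⬝ᵥ Q *ᵥ x + (K *ᵥ x) ⬝ᵥ R *ᵥ K *ᵥ x + V ((A + B * K) *ᵥ x) ≤ V x)
    (k : ℕ) (x : ι → ℝ) : x ⬝ᵥ riccatiIterate A B Q R k *ᵥ x ≤ V x := by
  induction k generalizing x with
  | zero => simpa only [riccatiIterate, zero_mulVec, dotProduct_zero] using hV x
  | succ k ih =>
    have hstep := dotProduct_riccatiStep_mulVec_le (A := A) (B := B) (Q := Q) hR
      (posSemidef_riccatiIterate (A := A) (B := B) hQ hR k) x (K *ᵥ x)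
    rw [mulVec_mulVec _ B, ← add_mulVec] at hstep
    exact hstep.trans ((add_le_add_right (ih _) _).trans (hK x))

theorem dotProduct_eq_zero_of_riccatiIterate_succ (hQ : Q.PosSemidef) (hR : R.PosDef) {k : ℕ}
    {x : ι → ℝ} (h : x ⬝ᵥ riccatiIterate A B Q R (k + 1) *ᵥ x = 0) :
    x ⬝ᵥ Q *ᵥ x = 0 ∧ (A *ᵥ x) ⬝ᵥ riccatiIterate A B Q R k *ᵥ A *ᵥ x = 0 := by
  have hx := (posSemidef_real_iff.1 hQ).2 x
  have hV := dotProduct_riccatiIterate_mulVec_nonneg (A := A) (B := B) hQ hR k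
    (closedLoop A B R (riccatiIterate A B Q R k) *ᵥ x)
  rw [riccatiIterate, dotProduct_riccatiStep_mulVec_eq hR (posSemidef_riccatiIterate hQ hR k)] at h
  set u := optimalControl A B R (riccatiIterate A B Q R k) 0 x with hu
  have hu_nonneg := (posSemidef_real_iff.1 hR.posSemidef).2 u
  have hu_zero : u = 0 := by
    by_contra hne
    have : 0 < u ⬝ᵥ R *ᵥ u := by simpa only [star_trivial] using hR.dotProduct_mulVec_pos hne
    linarith
  have hclosed : closedLoop A B R (riccatiIterate A B Q R k) *ᵥ x = A *ᵥ x := by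
    rw [← add_mulVec_optimalControl_zero, ← hu, hu_zero, mulVec_zero, add_zero]
  rw [hclosed] at h hV
  constructor <;> linarith

theorem sum_riccatiIterate_add_le (hQ : Q.PosSemidef) (hR : R.PosDef) (N : ℕ) (x : ι → ℝ)
    (u : κ → ℝ) :
    ∑ i ∈ Finset.range N, x ⬝ᵥ riccatiIterate A B Q R i *ᵥ x
        + x ⬝ᵥ riccatiIterate A B Q R N *ᵥ x
      ≤ N * (x ⬝ᵥ Q *ᵥ x + u ⬝ᵥ R *ᵥ u)
        + ∑ i ∈ Finset.range N,
          (A *ᵥ x + B *ᵥ u) ⬝ᵥ riccatiIterate A B Q R i *ᵥ (A *ᵥ x + B *ᵥ u) := by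
  rw [← Finset.sum_range_succ, Finset.sum_range_succ', riccatiIterate, zero_mulVec,
    dotProduct_zero, add_zero, ← nsmul_eq_mul]
  nth_rw 2 [← Finset.card_range N]
  rw [← Finset.sum_const, ← Finset.sum_add_distrib]
  exact Finset.sum_le_sum fun i _ =>
    dotProduct_riccatiStep_mulVec_le hR (posSemidef_riccatiIterate hQ hR i) x u

theorem mul_riccatiIterate_closedLoop_sub_add_le (hQ : Q.PosSemidef) (hR : R.PosDef) {N : ℕ}
    {a l : ℝ} (hl : 0 ≤ l) (ha : l * N ≤ a)
    (hlow : ∀ x, x ⬝ᵥ x ≤ l * (x ⬝ᵥ riccatiIterate A B Q R N *ᵥ x)) (k : ℕ) {x y : ι → ℝ}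
    (hy : y = closedLoop A B R (riccatiIterate A B Q R k) *ᵥ x) :
    a * (y ⬝ᵥ riccatiIterate A B Q R k *ᵥ y)
        - l * ∑ i ∈ Finset.range N, y ⬝ᵥ riccatiIterate A B Q R i *ᵥ y + x ⬝ᵥ x
      ≤ a * (x ⬝ᵥ riccatiIterate A B Q R (k + 1) *ᵥ x)
        - l * ∑ i ∈ Finset.range N, x ⬝ᵥ riccatiIterate A B Q R i *ᵥ x := by
  set u := optimalControl A B R (riccatiIterate A B Q R k) 0 x with hu
  have hstep : x ⬝ᵥ riccatiIterate A B Q R (k + 1) *ᵥ x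
      = x ⬝ᵥ Q *ᵥ x + u ⬝ᵥ R *ᵥ u + y ⬝ᵥ riccatiIterate A B Q R k *ᵥ y :=
    hy ▸ dotProduct_riccatiStep_mulVec_eq hR (posSemidef_riccatiIterate hQ hR k) x
  have hcost := sum_riccatiIterate_add_le (A := A) (B := B) hQ hR N x u
  rw [hu, add_mulVec_optimalControl_zero, ← hy] at hcost
  have hstage : 0 ≤ (a - l * N) * (x ⬝ᵥ Q *ᵥ x + u ⬝ᵥ R *ᵥ u) :=
    mul_nonneg (sub_nonneg.2 ha) (add_nonneg ((posSemidef_real_iff.1 hQ).2 x)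
      ((posSemidef_real_iff.1 hR.posSemidef).2 u))
  have := mul_le_mul_of_nonneg_left hcost hl
  have := hlow x
  rw [hstep]
  linarith

-- With `V_k` the form of `riccatiIterate k` and `Z = ∑_{i<N} V_i`, the Lyapunov functions are
-- `a V_{N+j} - l Z`. Along the optimal loop the first term decreases by `a` times the stage cost,
-- and `Z` decreases by at most `N` times the stage cost minus `V_N`, which is coercive.
theorem exists_lyapunov_closedLoop (hQ : Q.PosSemidef) (hR : R.PosDef) {N : ℕ} {l C : ℝ}
    (hl : 0 ≤ l) (hC : 0 ≤ C) (hlow : ∀ x, x ⬝ᵥ x ≤ l * (x ⬝ᵥ riccatiIterate A B Q R N *ᵥ x))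
    (hup : ∀ k x, x ⬝ᵥ riccatiIterate A B Q R k *ᵥ x ≤ C * (x ⬝ᵥ x)) :
    ∃ (Y : ℕ → (ι → ℝ) → ℝ) (β : ℝ), 0 < β ∧ (∀ j x, x ⬝ᵥ x ≤ Y j x) ∧
      (∀ j x, Y j x ≤ β * (x ⬝ᵥ x)) ∧
      ∀ j x, Y j (closedLoop A B R (riccatiIterate A B Q R (N + j)) *ᵥ x) + x ⬝ᵥ x
        ≤ Y (j + 1) x := by
  let V (k : ℕ) (x : ι → ℝ) : ℝ := x ⬝ᵥ riccatiIterate A B Q R k *ᵥ x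
  let Z (x : ι → ℝ) : ℝ := ∑ i ∈ Finset.range N, V i x
  have hV (k : ℕ) (x : ι → ℝ) : 0 ≤ V k x := dotProduct_riccatiIterate_mulVec_nonneg hQ hR k x
  have hZ (x : ι → ℝ) : 0 ≤ Z x := Finset.sum_nonneg fun i _ => hV i x
  have hVN (x : ι → ℝ) : x ⬝ᵥ x ≤ l * V N x := hlow x
  have hZ_le (x : ι → ℝ) : Z x ≤ N * C * (l * V N x) := by
    have hsum : Z x ≤ ∑ _ ∈ Finset.range N, C * (x ⬝ᵥ x) := Finset.sum_le_sum fun i _ => hup i x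
    rw [Finset.sum_const, Finset.card_range, nsmul_eq_mul, ← mul_assoc] at hsum
    exact hsum.trans (mul_le_mul_of_nonneg_left (hVN x) (by positivity))
  set a := l * N + l * (1 + N * C * l)
  have hdec (j : ℕ) (x : ι → ℝ) := mul_riccatiIterate_closedLoop_sub_add_le hQ hR hl
    (show l * N ≤ a from le_add_of_nonneg_right (by positivity)) hlow (N + j) (x := x) rfl
  have hcoercive (j : ℕ) (x : ι → ℝ) : x ⬝ᵥ x ≤ a * V (N + j) x - l * Z x := by
    induction j generalizing x with
    | zero =>
      have ha : 0 ≤ l * N * V N x := mul_nonneg (by positivity) (hV N x)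
      have := mul_le_mul_of_nonneg_left (hZ_le x) hl
      rw [add_zero]
      linarith [hVN x]
    | succ j ih =>
      exact (le_add_of_nonneg_left ((dotProduct_self_star_nonneg _).trans (ih _))).trans (hdec j x)
  refine ⟨fun j x => a * V (N + j) x - l * Z x, a * C + 1, by positivity, hcoercive,
    fun j x => ?_, hdec⟩
  have hle : a * V (N + j) x ≤ a * (C * (x ⬝ᵥ x)) :=
    mul_le_mul_of_nonneg_left (hup (N + j) x) (by positivity)
  have : 0 ≤ x ⬝ᵥ x := dotProduct_self_star_nonneg x
  linarith [mul_nonneg hl (hZ x)]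

end Iterates

section Boundedness

open scoped Matrix.Norms.L2Operator

variable {ι κ : Type*} [Fintype ι] [Fintype κ] [DecidableEq ι] [DecidableEq κ]
  {A : Matrix ι ι ℝ} {B : Matrix ι κ ℝ} {Q : Matrix ι ι ℝ} {R : Matrix κ κ ℝ}

theorem exists_norm_riccatiIterate_le (hQ : Q.PosSemidef) (hR : R.PosDef) {K : Matrix κ ι ℝ}
    (hK : ∀ x, Tendsto (fun t : ℕ => ((A + B * K) ^ t) *ᵥ x) atTop (𝓝 0)) :
    ∃ C, 0 ≤ C ∧ ∀ k, ‖riccatiIterate A B Q R k‖ ≤ C := by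
  obtain ⟨H, hH, hlyap⟩ := exists_lyapunov hK
  set q := ‖Q + Kᵀ * (R * K)‖
  have hq (x : ι → ℝ) : x ⬝ᵥ Q *ᵥ x + (K *ᵥ x) ⬝ᵥ R *ᵥ K *ᵥ x ≤ q * (x ⬝ᵥ x) := by
    have h := dotProduct_mulVec_le_norm (Q + Kᵀ * (R * K)) x
    rwa [add_mulVec, dotProduct_add, dotProduct_transpose_mul_mulVec, ← mulVec_mulVec] at h
  have hV (k : ℕ) (x : ι → ℝ) : x ⬝ᵥ riccatiIterate A B Q R k *ᵥ x ≤ q * (x ⬝ᵥ H *ᵥ x) := by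
    refine dotProduct_riccatiIterate_mulVec_le_of_lyapunov (K := K) hQ hR
      (fun x => mul_nonneg (norm_nonneg _) ((posSemidef_real_iff.1 hH).2 x)) (fun x => ?_) k x
    have := mul_le_mul_of_nonneg_left (hlyap x) (norm_nonneg (Q + Kᵀ * (R * K)))
    linarith [hq x]
  refine ⟨q * ‖H‖, by positivity, fun k =>
    l2_opNorm_le_of_posSemidef (posSemidef_riccatiIterate hQ hR k) (by positivity) fun x => ?_⟩
  rw [mul_assoc]
  exact (hV k x).trans (mul_le_mul_of_nonneg_left (dotProduct_mulVec_le_norm H x) (norm_nonneg _))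

omit [DecidableEq ι] in
theorem adjointIterate_succ_transpose_mulVec (hQ : Q.PosSemidef) (hR : R.PosDef) (k : ℕ)
    (x : ι → ℝ) :
    (adjointIterate A B Q R (k + 1))ᵀ *ᵥ x
      = (riccatiIterate A B Q R k + (adjointIterate A B Q R k)ᵀ) *ᵥ
          closedLoop A B R (riccatiIterate A B Q R k) *ᵥ x := by
  rw [adjointIterate, adjointStep, transpose_mul, transpose_transpose, transpose_add,
    (posSemidef_real_iff.1 (posSemidef_riccatiIterate hQ hR k)).1.eq, mulVec_mulVec]

theorem exists_norm_adjointIterate_le (hQ : Q.PosSemidef) (hR : R.PosDef) {N : ℕ} {l C : ℝ}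
    (hl : 0 ≤ l) (hC : 0 ≤ C) (hlow : ∀ x, x ⬝ᵥ x ≤ l * (x ⬝ᵥ riccatiIterate A B Q R N *ᵥ x))
    (hup : ∀ k, ‖riccatiIterate A B Q R k‖ ≤ C) :
    ∃ c, ∀ k, ‖adjointIterate A B Q R k‖ ≤ c := by
  obtain ⟨Y, β, hβ, hYlow, hYup, hdec⟩ := exists_lyapunov_closedLoop hQ hR hl hC hlow fun k x =>
    (dotProduct_mulVec_le_norm _ x).trans
      (mul_le_mul_of_nonneg_right (hup k) (dotProduct_self_star_nonneg x))
  have hmulVec (M : Matrix ι ι ℝ) (x : ι → ℝ) :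
      ‖WithLp.toLp 2 (M *ᵥ x)‖ ≤ ‖M‖ * ‖WithLp.toLp 2 x‖ := l2_opNorm_mulVec M (WithLp.toLp 2 x)
  obtain ⟨c, hc, hle⟩ := exists_le_mul_of_lyapunov (ν := fun x : ι → ℝ => ‖WithLp.toLp 2 x‖)
    (Φ := fun j x => closedLoop A B R (riccatiIterate A B Q R (N + j)) *ᵥ x)
    (f := fun j x => ‖WithLp.toLp 2 ((adjointIterate A B Q R (N + j))ᵀ *ᵥ x)‖)
    (b := ‖(adjointIterate A B Q R N)ᵀ‖) (p := C) (fun _ => norm_nonneg _) hβ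
    (by simpa only [norm_sq_toLp] using hYlow) (by simpa only [norm_sq_toLp] using hYup)
    (by simpa only [norm_sq_toLp] using hdec) (norm_nonneg _) hC (fun x => hmulVec _ x)
    (fun j x => by
      rw [← add_assoc, adjointIterate_succ_transpose_mulVec hQ hR, add_mulVec, WithLp.toLp_add,
        add_comm]
      exact norm_add_le_of_le le_rfl
        ((hmulVec _ _).trans (mul_le_mul_of_nonneg_right (hup _) (norm_nonneg _))))
  have htail (j : ℕ) : ‖adjointIterate A B Q R (N + j)‖ ≤ c := by
    rw [← l2_opNorm_transpose]
    refine l2_opNorm_le_of_forall hc fun x => ?_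
    rw [← norm_sq_toLp, ← norm_sq_toLp, ← mul_pow]
    exact pow_le_pow_left₀ (norm_nonneg _) (hle j x) 2
  have hbdd : IsBoundedUnder (· ≤ ·) atTop fun k => ‖adjointIterate A B Q R k‖ := by
    refine isBoundedUnder_of_eventually_le (a := c) ?_
    filter_upwards [eventually_ge_atTop N] with k hk
    exact Nat.add_sub_cancel' hk ▸ htail (k - N)
  obtain ⟨c', hc'⟩ := hbdd.bddAbove_range
  exact ⟨c', fun k => hc' ⟨k, rfl⟩⟩

theorem norm_errorWeight_le (hR : R.PosDef) {P L : Matrix ι ι ℝ} (hP : P.PosSemidef)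
    {r : ℝ} (hr : 0 ≤ r) (hRr : ∀ u, u ⬝ᵥ u ≤ r * (u ⬝ᵥ R *ᵥ u)) :
    ‖errorWeight B R P L‖ ≤ (‖P‖ + ‖L‖) ^ 2 * ‖B‖ ^ 2 * r := by
  have hΥ := posDef_controlWeight B hR hP
  have hinv : ‖(controlWeight B R P)⁻¹‖ ≤ r := by
    refine l2_opNorm_inv_le_of_coercive hΥ.isUnit hr fun u =>
      (hRr u).trans (mul_le_mul_of_nonneg_left ?_ hr)
    have hPB := (posSemidef_real_iff.1 hP).2 (B *ᵥ u)
    rw [controlWeight, add_mulVec, dotProduct_add, Matrix.mul_assoc,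
      dotProduct_transpose_mul_mulVec, ← mulVec_mulVec]
    exact le_add_of_nonneg_right hPB
  have hPL : ‖P + L‖ ≤ ‖P‖ + ‖L‖ := norm_add_le P L
  calc ‖errorWeight B R P L‖
      ≤ ‖(P + L)ᵀ‖ * ‖B‖ * ‖(controlWeight B R P)⁻¹‖ * ‖Bᵀ‖ * ‖P + L‖ := by
        rw [errorWeight]
        refine (l2_opNorm_mul _ _).trans (mul_le_mul_of_nonneg_right ?_ (norm_nonneg _))
        refine (l2_opNorm_mul _ _).trans (mul_le_mul_of_nonneg_right ?_ (norm_nonneg _))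
        refine (l2_opNorm_mul _ _).trans (mul_le_mul_of_nonneg_right ?_ (norm_nonneg _))
        exact l2_opNorm_mul _ _
    _ = ‖P + L‖ ^ 2 * ‖B‖ ^ 2 * ‖(controlWeight B R P)⁻¹‖ := by
        rw [l2_opNorm_transpose, l2_opNorm_transpose]
        ring
    _ ≤ (‖P‖ + ‖L‖) ^ 2 * ‖B‖ ^ 2 * r := by gcongr

end Boundedness

section Observability

theorem exists_forall_lt_imp_of_observable {n q : ℕ} {A : Matrix (Fin n) (Fin n) ℝ}
    {C : Matrix (Fin q) (Fin n) ℝ} (h : Observable A C) :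
    ∃ N : ℕ, ∀ x, (∀ i < N, C *ᵥ ((A ^ i) *ᵥ x) = 0) → x = 0 := by
  let W (k : ℕ) : Submodule ℝ (Fin n → ℝ) :=
    ⨅ i < k, LinearMap.ker (C * A ^ i).mulVecLin
  have hW (k : ℕ) (x : Fin n → ℝ) : x ∈ W k ↔ ∀ i < k, C *ᵥ ((A ^ i) *ᵥ x) = 0 := by
    simp only [W, Submodule.mem_iInf, LinearMap.mem_ker, mulVecLin_apply, mulVec_mulVec]
  have hanti : Antitone W := fun k k' hkk' x hx =>
    (hW k x).2 fun i hi => (hW k' x).1 hx i (hi.trans_le hkk')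
  obtain ⟨N, hN⟩ := IsArtinian.monotone_stabilizes ⟨fun k => OrderDual.toDual (W k), hanti⟩
  refine ⟨N, fun x hx => h x fun t => ?_⟩
  have hstab : W N = W (max N (t + 1)) := hN _ (le_max_left _ _)
  exact (hW _ x).1 (hstab ▸ (hW N x).2 hx) t (le_max_right N (t + 1))

variable {n m : ℕ} {A : Matrix (Fin n) (Fin n) ℝ} {B : Matrix (Fin n) (Fin m) ℝ}
  {Q : Matrix (Fin n) (Fin n) ℝ} {R : Matrix (Fin m) (Fin m) ℝ}

theorem sqrt_mulVec_eq_zero (hQ : Q.PosSemidef) {x : Fin n → ℝ} (h : x ⬝ᵥ Q *ᵥ x = 0) :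
    CFC.sqrt Q *ᵥ x = 0 := by
  have hsymm := (posSemidef_real_iff.1 (nonneg_iff_posSemidef.1 (CFC.sqrt_nonneg Q))).1
  rw [← CFC.sqrt_mul_sqrt_self Q hQ.nonneg] at h
  nth_rw 1 [← hsymm.eq] at h
  rwa [dotProduct_transpose_mul_mulVec, dotProduct_self_eq_zero] at h

theorem sqrt_mulVec_pow_mulVec_eq_zero (hQ : Q.PosSemidef) (hR : R.PosDef) {k : ℕ}
    {x : Fin n → ℝ} (h : x ⬝ᵥ riccatiIterate A B Q R k *ᵥ x = 0) :
    ∀ i < k, CFC.sqrt Q *ᵥ ((A ^ i) *ᵥ x) = 0 := by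
  induction k generalizing x with
  | zero => exact fun i hi => absurd hi i.not_lt_zero
  | succ k ih =>
    obtain ⟨hx, hAx⟩ := dotProduct_eq_zero_of_riccatiIterate_succ hQ hR h
    rintro (_ | i) hi
    · rw [pow_zero, one_mulVec]
      exact sqrt_mulVec_eq_zero hQ hx
    · rw [pow_succ, ← mulVec_mulVec]
      exact ih hAx i (Nat.lt_of_succ_lt_succ hi)

theorem exists_dotProduct_self_le_riccatiIterate (hQ : Q.PosSemidef) (hR : R.PosDef)
    (hobs : Observable A (CFC.sqrt Q)) :
    ∃ (N : ℕ) (l : ℝ), 0 ≤ l ∧ ∀ x, x ⬝ᵥ x ≤ l * (x ⬝ᵥ riccatiIterate A B Q R N *ᵥ x) := by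
  obtain ⟨N, hN⟩ := exists_forall_lt_imp_of_observable hobs
  have hV := posSemidef_riccatiIterate (A := A) (B := B) hQ hR N
  refine ⟨N, exists_dotProduct_self_le_of_posDef <|
    .of_dotProduct_mulVec_pos hV.isHermitian fun x hx => ?_⟩
  rw [star_trivial]
  exact ((posSemidef_real_iff.1 hV).2 x).lt_of_ne' fun h =>
    hx (hN x (sqrt_mulVec_pow_mulVec_eq_zero hQ hR h))

theorem riccatiBack_const (T k : ℕ) :
    riccatiBack A B (fun _ => Q) (fun _ => R) 0 T k = riccatiIterate A B Q R k := by
  induction k with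
  | zero => rfl
  | succ k ih =>
    rw [riccatiBack, ih]
    rfl

theorem adjointBack_const (hQ : Q.PosSemidef) (hR : R.PosDef) (T k : ℕ) :
    adjointBack A B (fun _ => Q) (fun _ => R) 0 T k = adjointIterate A B Q R k := by
  induction k with
  | zero => rfl
  | succ k ih =>
    rw [adjointBack, ih, riccatiBack_const, adjointIterate, adjointStep,
      closedLoop_transpose (posSemidef_real_iff.1 hR.posSemidef).1
        (posSemidef_real_iff.1 (posSemidef_riccatiIterate hQ hR k)).1]
    rfl

theorem matD_const (hQ : Q.PosSemidef) (hR : R.PosDef) (T t : ℕ) :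
    matD A B (fun _ => Q) (fun _ => R) 0 T t
      = errorWeight B R (riccatiIterate A B Q R (T - t)) (adjointIterate A B Q R (T - t)) := by
  rw [← riccatiBack_const T, ← adjointBack_const hQ hR T, ← Nat.add_sub_add_right T 1 t]
  rfl

open scoped Matrix.Norms.L2Operator in
theorem exists_dotProduct_matD_mulVec_le (hQ : Q.PosSemidef) (hR : R.PosDef)
    (hstab : Stabilizable A B) (hobs : Observable A (CFC.sqrt Q)) :
    ∃ C, 0 ≤ C ∧ ∀ T t x,
      x ⬝ᵥ matD A B (fun _ => Q) (fun _ => R) 0 T t *ᵥ x ≤ C * (x ⬝ᵥ x) := by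
  obtain ⟨K, hK⟩ := hstab
  obtain ⟨p, hp, hP⟩ := exists_norm_riccatiIterate_le hQ hR hK
  obtain ⟨N, l, hl, hlow⟩ := exists_dotProduct_self_le_riccatiIterate (B := B) hQ hR hobs
  obtain ⟨q, hL⟩ := exists_norm_adjointIterate_le hQ hR hl hp hlow hP
  obtain ⟨r, hr, hRr⟩ := exists_dotProduct_self_le_of_posDef hR
  refine ⟨(p + q) ^ 2 * ‖B‖ ^ 2 * r, by positivity, fun T t x =>
    (dotProduct_mulVec_le_norm _ x).trans
      (mul_le_mul_of_nonneg_right ?_ (dotProduct_self_star_nonneg x))⟩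
  rw [matD_const hQ hR]
  refine (norm_errorWeight_le hR (posSemidef_riccatiIterate hQ hR _) hr hRr).trans ?_
  gcongr
  exacts [hP _, hL _]

end Observability

theorem isBigO_log_of_le_add_mul_sum_one_div {f : ℕ → ℝ} {a K : ℝ} (ha : 0 ≤ a) (hK : 0 ≤ K)
    (hf : ∀ T, 0 ≤ f T) (h : ∀ T, f T ≤ a + K * ∑ t ∈ Finset.Icc 1 T, 1 / (t : ℝ)) :
    f =O[atTop] fun T : ℕ => Real.log T := by
  have hharm (T : ℕ) : ∑ t ∈ Finset.Icc 1 T, 1 / (t : ℝ) ≤ 1 + Real.log T := by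
    simpa [harmonic_eq_sum_Icc] using harmonic_le_one_add_log T
  have hlog : ∀ᶠ T : ℕ in atTop, 1 ≤ Real.log T :=
    (Real.tendsto_log_atTop.comp tendsto_natCast_atTop_atTop).eventually_ge_atTop 1
  refine Asymptotics.IsBigO.of_bound (a + K * 2) ?_
  filter_upwards [hlog] with T hT
  rw [Real.norm_of_nonneg (hf T), Real.norm_of_nonneg (zero_le_one.trans hT), add_mul]
  calc f T ≤ a + K * (1 + Real.log T) :=
        (h T).trans (by gcongr; exact hharm T)
    _ ≤ a * Real.log T + K * (2 * Real.log T) := by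
        gcongr
        · exact le_mul_of_one_le_right ha hT
        · linarith
    _ = a * Real.log T + K * 2 * Real.log T := by ring

end OnlineLQ

theorem theorem3 {n m M : ℕ}
    (A : Matrix (Fin n) (Fin n) ℝ) (B : Matrix (Fin n) (Fin m) ℝ)
    (Q : Matrix (Fin n) (Fin n) ℝ) (R : Matrix (Fin m) (Fin m) ℝ)
    (hQ : Q.PosSemidef) (hR : R.PosDef)
    (hstab : OnlineLQ.Stabilizable A B) (hobs : OnlineLQ.Observable A (CFC.sqrt Q))
    {Ω : Type*} [MeasurableSpace Ω] (μ : Measure Ω) [IsProbabilityMeasure μ]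
    (v : Fin M → Fin n → ℝ) (p : Fin M → ℝ) (w : ℕ → Ω → Fin n → ℝ)
    (hw : OnlineLQ.IsNoise μ v p w) :
    (∃ c : ℝ, 0 < c ∧ ∀ (x₀ : Fin n → ℝ) (T : ℕ),
      OnlineLQ.regret A B (fun _ => Q) (fun _ => R) 0 T x₀ w μ v
        ≤ (OnlineLQ.matD A B (fun _ => Q) (fun _ => R) 0 T 0
              * Matrix.vecMulVec (OnlineLQ.noiseMean v p) (OnlineLQ.noiseMean v p)).trace
          + c * ∑ t ∈ Finset.Icc 1 T, 1 / (t : ℝ)) ∧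
    ∀ x₀ : Fin n → ℝ,
      (fun T : ℕ => OnlineLQ.regret A B (fun _ => Q) (fun _ => R) 0 T x₀ w μ v)
        =O[atTop] (fun T : ℕ => Real.log (T : ℝ)) := by
  obtain ⟨C, hC, hD⟩ := OnlineLQ.exists_dotProduct_matD_mulVec_le hQ hR hstab hobs
  set K := C * (n * ‖v‖ ^ 2)
  have hK : 0 ≤ K := by positivity
  have hregret (x₀ : Fin n → ℝ) (T : ℕ) :=
    OnlineLQ.regret_le_trace_add (x₀ := x₀) (fun _ => hQ) (fun _ => hR) .zero hw hC (hD T)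
  refine ⟨⟨K + 1, by positivity, fun x₀ T => (hregret x₀ T).trans ?_⟩, fun x₀ => ?_⟩
  · gcongr
    exact le_add_of_nonneg_right zero_le_one
  · refine OnlineLQ.isBigO_log_of_le_add_mul_sum_one_div (K := K)
      (mul_nonneg hC (dotProduct_self_star_nonneg (OnlineLQ.noiseMean v p))) hK
      (fun T => OnlineLQ.regret_nonneg (fun _ => hQ) (fun _ => hR) .zero hw)
      fun T => (hregret x₀ T).trans (add_le_add_left ?_ _)
    rw [OnlineLQ.trace_mul_vecMulVec_self]
    exact hD T 0 _
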